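/- Let $M$ be an integral lattice of signature $(2,n)$, $n\ge 1$, with an orthogonal splitting $M=U\oplus L$, where $U=\mathbb{Z}e\oplus\mathbb{Z}f$, $e^2=f^2=0$, $\langle e,f\rangle=1$. Let $\mathrm{Aff}(\mathcal{D})$ be one of the two connected components of $\{Z\in M_{\mathbb{C}} : \langle Z,Z\rangle=0,\ \langle Z,\overline{Z}\rangle>0\}$, let $\mathcal{D}\subset\mathbb{P}(M_{\mathbb{C}})$ be its image, and let $\mathcal{L}$, $\mathcal{E}=\mathcal{L}^\perp/\mathcal{L}$ be the Hodge bundles on $\mathcal{D}$, with fibres $\mathbb{C}Z$ and $Z^\perp/\mathbb{C}Z$. Let $\mathcal{C}\subset L_{\mathbb{C}}$ be the component of $\{z : \langle\operatorname{Im}z,\operatorname{Im}z\rangle>0\}$ mapped to $\mathcal{D}$ by $\widetilde\varphi(z)=-\tfrac12\langle z,z\rangle e+z+f$. By means of $\widetilde\varphi$ and its derivative, sections of $\mathcal{L}^{k}\otimes\mathcal{E}^{\otimes s}$ are identified with functions $F$ on $\mathcal{C}$ with values in $s$-linear forms on $L_{\mathbb{C}}$. Write $y=\operatorname{Im}z$,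 $g_{ij}=\langle e_i,e_j\rangle$ for a basis $e_1,\dots,e_n$ of $L$, and $\nu_j=\frac{\partial}{\partial z_j}\log\langle y,y\rangle$. Let $\Gamma$ be a finite-index subgroup of the group $\mathrm{O}^+(M)$ of isometries of $M$ preserving $\mathcal{D}$, and let $k\in\mathbb{Z}$, $s\ge 0$. Let $\mathsf{AHMod}_{k,s}(\Gamma)$ be the complex vector space of $\Gamma$-invariant smooth sections $F$ of $\mathcal{L}^{k}\otimes\mathcal{E}^{\otimes s}$ over $\mathcal{D}$ with $\mathsf{L}^{d+1}F=0$ for some $d\ge 0$, where $$\mathsf{L}(F)_{i_1,\dots,i_s,a}=\langle y,y\rangle\frac{\partial F_{i_1,\dots,i_s}}{\partial\overline{z}_a}-2\sum_{b,c}\frac{\partial F_{i_1,\dots,i_s}}{\partial\overline{z}_b}\,y_b\,g_{ac}\,y_c .$$ If $n\le 2$, one requires in addition that at every $0$-dimensional cusp and for every $d\ge 0$ the holomorphic function $(\mathsf{L}^dF)|_{\nu=0}$ on the tube domain of the cusp has a Fourier expansion supported on the closure of the positive cone that corresponds to this tube domain. Then every $F\in\mathsf{AHMod}_{k,s}(\Gamma)$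 is on $\mathcal{C}$ a polynomial in $\nu_1,\dots,\nu_n$ with holomorphic coefficients, its value $F|_{\nu=0}$ at $\nu_1=\dots=\nu_n=0$ is well defined, and, with $\mathsf{QMod}_{k,s}(\Gamma)=\{F|_{\nu=0} : F\in\mathsf{AHMod}_{k,s}(\Gamma)\}$ the space of quasimodular forms of weight $k$ and rank $s$ for $\Gamma$, the constant-term map $$\mathrm{ct}:\mathsf{AHMod}_{k,s}(\Gamma)\longrightarrow\mathsf{QMod}_{k,s}(\Gamma),\qquad F\longmapsto F|_{\nu=0},$$ is an isomorphism of complex vector spaces. -/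

import Mathlib

open scoped ContDiff ComplexConjugate

noncomputable section

/-! ### Lattices of signature `(2, n)`, the period domain and the group `O⁺(M)` -/

/-- A lattice `M` of signature `(2, n)`, given by its Gram matrix in a `ℤ`-basis:
`M = ℤ^(n+2)` with the integral symmetric bilinear form `(x, y) ↦ xᵗ G y`. -/
structure OrthLattice (n : ℕ) where
  gram : Matrix (Fin (n + 2)) (Fin (n + 2)) ℤ
  symm : gram.IsSymm
  sigPos_eq : _root_.sigPos
    (Matrix.toBilin' (gram.map (Int.cast : ℤ → ℝ))).toQuadraticMap = 2
  sigNeg_eq : _root_.sigNeg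
    (Matrix.toBilin' (gram.map (Int.cast : ℤ → ℝ))).toQuadraticMap = n

/-- The complexification `M_ℂ` in the coordinates given by the basis of `M`. -/
abbrev CVec (n : ℕ) := Fin (n + 2) → ℂ

/-- A real vector of `M_ℝ`, viewed in `M_ℂ`. -/
def realVec {n : ℕ} (x : Fin (n + 2) → ℝ) : CVec n := fun i => (x i : ℂ)

namespace OrthLattice

variable {n : ℕ} (M : OrthLattice n)

/-- The `ℂ`-bilinear extension `⟨·, ·⟩` of the form of `M` to `M_ℂ`. -/
def form : LinearMap.BilinForm ℂ (CVec n) :=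
  Matrix.toBilin' (M.gram.map (Int.cast : ℤ → ℂ))

lemma form_apply (x y : CVec n) :
    M.form x y = ∑ i, ∑ j, x i * (M.gram i j : ℂ) * y j := by
  simp [form, Matrix.toBilin'_apply]

lemma form_comm (x y : CVec n) : M.form x y = M.form y x := by
  rw [form_apply, form_apply, Finset.sum_comm]
  refine Finset.sum_congr rfl fun i _ => Finset.sum_congr rfl fun j _ => ?_
  rw [← M.symm.apply i j]
  ring

lemma form_star (x y : CVec n) : M.form (star x) (star y) = conj (M.form x y) := by
  simp [form_apply, map_sum]

/-- `{Z ∈ M_ℂ : ⟨Z, Z⟩ = 0, ⟨Z, Z̄⟩ > 0}`, the union of the two affine cones. -/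
def cone : Set (CVec n) := {Z | M.form Z Z = 0 ∧ 0 < (M.form Z (star Z)).re}

/-- The affine cone `Aff(𝓓)` over the period domain `𝓓 = 𝓓⁺`: the connected component of the
point `Z₀` in `cone`. The choice of `Z₀` is the choice of one of the two components. -/
def aff (Z₀ : CVec n) : Set (CVec n) := connectedComponentIn M.cone Z₀

/-- The action of an integral matrix on `M_ℂ`. -/
def act (γ : GL (Fin (n + 2)) ℤ) : CVec n →ₗ[ℂ] CVec n :=
  Matrix.mulVecLin ((γ : Matrix (Fin (n + 2)) (Fin (n + 2)) ℤ).map (Int.cast : ℤ → ℂ))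

lemma act_one (Z : CVec n) : act (1 : GL (Fin (n + 2)) ℤ) Z = Z := by
  simp [act, Matrix.map_one]

lemma act_mul (γ δ : GL (Fin (n + 2)) ℤ) (Z : CVec n) : act (γ * δ) Z = act γ (act δ Z) := by
  have h := Matrix.map_mul (L := (γ : Matrix (Fin (n + 2)) (Fin (n + 2)) ℤ))
    (M := (δ : Matrix (Fin (n + 2)) (Fin (n + 2)) ℤ)) (f := Int.castRingHom ℂ)
  have h' : ((γ * δ : GL (Fin (n + 2)) ℤ) : Matrix (Fin (n + 2)) (Fin (n + 2)) ℤ).map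
      (Int.cast : ℤ → ℂ) =
      (γ : Matrix (Fin (n + 2)) (Fin (n + 2)) ℤ).map (Int.cast : ℤ → ℂ) *
      (δ : Matrix (Fin (n + 2)) (Fin (n + 2)) ℤ).map (Int.cast : ℤ → ℂ) := by
    simpa using h
  simp only [act, Matrix.mulVecLin_apply, h', Matrix.mulVec_mulVec]

/-- The group `O⁺(M)`: the isometries of `M` that preserve the chosen component (equivalently,
both components). -/
def OPlus (Z₀ : CVec n) : Subgroup (GL (Fin (n + 2)) ℤ) where
  carrier := {γ | (γ : Matrix (Fin (n + 2)) (Fin (n + 2)) ℤ).transpose * M.gram * γ = M.gram ∧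
    ∀ Z : CVec n, act γ Z ∈ M.aff Z₀ ↔ Z ∈ M.aff Z₀}
  one_mem' := by simp [act_one]
  mul_mem' := by
    rintro γ δ ⟨h₁, h₂⟩ ⟨h₃, h₄⟩
    refine ⟨?_, fun Z => by rw [act_mul, h₂, h₄]⟩
    rw [Units.val_mul, Matrix.transpose_mul]
    calc _ = (δ : Matrix (Fin (n + 2)) (Fin (n + 2)) ℤ).transpose *
          ((γ : Matrix (Fin (n + 2)) (Fin (n + 2)) ℤ).transpose * M.gram * γ) * δ := by
            simp only [Matrix.mul_assoc]
      _ = _ := by rw [h₁, h₃]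
  inv_mem' := by
    rintro γ ⟨h₁, h₂⟩
    refine ⟨?_, fun Z => by rw [← h₂, ← act_mul, mul_inv_cancel, act_one]⟩
    have h : (γ : Matrix (Fin (n + 2)) (Fin (n + 2)) ℤ) *
        ((γ⁻¹ : GL (Fin (n + 2)) ℤ) : Matrix (Fin (n + 2)) (Fin (n + 2)) ℤ) = 1 := by
      rw [← Units.val_mul, mul_inv_cancel, Units.val_one]
    have ht := congrArg Matrix.transpose h
    rw [Matrix.transpose_mul, Matrix.transpose_one] at ht
    conv_lhs => rw [← h₁]
    calc _ = (((γ⁻¹ : GL (Fin (n + 2)) ℤ) :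
              Matrix (Fin (n + 2)) (Fin (n + 2)) ℤ).transpose *
            (γ : Matrix (Fin (n + 2)) (Fin (n + 2)) ℤ).transpose) * M.gram *
            ((γ : Matrix (Fin (n + 2)) (Fin (n + 2)) ℤ) *
              ((γ⁻¹ : GL (Fin (n + 2)) ℤ) : Matrix (Fin (n + 2)) (Fin (n + 2)) ℤ)) := by
            simp only [Matrix.mul_assoc]
      _ = _ := by rw [h, ht, Matrix.one_mul, Matrix.mul_one]

/-! ### The Hodge bundles and their sections -/

/-- `Z^⊥ ⊆ M_ℂ`. -/
abbrev perp (Z : CVec n) : Submodule ℂ (CVec n) := LinearMap.ker (M.form Z)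

/-- The fibre `𝓔_Z = Z^⊥ / ℂ Z` of the second Hodge bundle. -/
abbrev HodgeE (Z : CVec n) :=
  ↥(M.perp Z) ⧸ (Submodule.span ℂ {Z}).comap (M.perp Z).subtype

/-- The class in `𝓔_Z` of a vector `u ∈ Z^⊥`. -/
def hodgeMk (Z u : CVec n) (hu : u ∈ M.perp Z) : M.HodgeE Z :=
  Submodule.Quotient.mk ⟨u, hu⟩

/-- Set-theoretic sections over `Aff(𝓓)` of the pullback of `𝓔^{⊗ s}`. The pairing on `𝓔` identifies
`𝓔` with its dual, hence `𝓔^{⊗ s}` with the bundle of `s`-linear forms on `𝓔`. -/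
abbrev HodgeSection (Z₀ : CVec n) (s : ℕ) :=
  (Z : M.aff Z₀) → MultilinearMap ℂ (fun _ : Fin s => M.HodgeE (Z : CVec n)) ℂ

variable {M}

/-- `F` is homogeneous of degree `-k`, so that it descends to a section of `𝓛^k ⊗ 𝓔^{⊗ s}`
over `𝓓`. -/
def IsHomog {Z₀ : CVec n} {s : ℕ} (k : ℤ) (F : M.HodgeSection Z₀ s) : Prop :=
  ∀ (Z Z' : M.aff Z₀) (c : ℂ), (Z' : CVec n) = c • (Z : CVec n) →
    ∀ (u : Fin s → CVec n) (hu : ∀ i, u i ∈ M.perp Z) (hu' : ∀ i, u i ∈ M.perp Z'),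
      F Z' (fun i => M.hodgeMk Z' (u i) (hu' i)) =
        c ^ (-k) * F Z (fun i => M.hodgeMk Z (u i) (hu i))

/-- `F` is invariant under the isometry `γ`. -/
def IsInvariant {Z₀ : CVec n} {s : ℕ} (γ : GL (Fin (n + 2)) ℤ) (F : M.HodgeSection Z₀ s) :
    Prop :=
  ∀ (Z Z' : M.aff Z₀), (Z' : CVec n) = act γ (Z : CVec n) →
    ∀ (u : Fin s → CVec n) (hu : ∀ i, u i ∈ M.perp Z) (hu' : ∀ i, act γ (u i) ∈ M.perp Z'),
      F Z' (fun i => M.hodgeMk Z' (act γ (u i)) (hu' i)) =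
        F Z (fun i => M.hodgeMk Z (u i) (hu i))

/-! ### Tube domains -/

variable (M)

/-- A hyperbolic pair in `M_ℝ`: isotropic vectors `e`, `f` with `⟨e, f⟩ = 1`. -/
structure HypPair where
  e : Fin (n + 2) → ℝ
  f : Fin (n + 2) → ℝ
  ee : M.form (realVec e) (realVec e) = 0
  ff : M.form (realVec f) (realVec f) = 0
  ef : M.form (realVec e) (realVec f) = 1

variable {M}

namespace HypPair

variable (P : M.HypPair)

/-- `e, f ∈ M`; then `U = ℤe ⊕ ℤf` is a hyperbolic plane and `M = U ⊕ L` with `L = U^⊥`. -/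
def IsIntegral : Prop := (∀ i, ∃ m : ℤ, P.e i = m) ∧ ∀ i, ∃ m : ℤ, P.f i = m

/-- `e, f ∈ M_ℚ`; then `M ∩ ℚe` is a zero-dimensional cusp, and every such cusp arises. -/
def IsRational : Prop := (∀ i, ∃ q : ℚ, P.e i = q) ∧ ∀ i, ∃ q : ℚ, P.f i = q

/-- `L_ℂ = {e, f}^⊥ ⊆ M_ℂ`. -/
def LC : Submodule ℂ (CVec n) :=
  LinearMap.ker (M.form (realVec P.e)) ⊓ LinearMap.ker (M.form (realVec P.f))

lemma star_realVec (x : Fin (n + 2) → ℝ) : star (realVec x) = realVec x := by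
  funext i
  simp [realVec]

/-- Complex conjugation on `L_ℂ`. -/
def bar (z : P.LC) : P.LC :=
  ⟨star (z : CVec n), by
    obtain ⟨z, h⟩ := z
    simp only [LC, Submodule.mem_inf, LinearMap.mem_ker] at h ⊢
    rw [← star_realVec P.e, ← star_realVec P.f, M.form_star, M.form_star, h.1, h.2]
    simp⟩

/-- The form of `M_ℂ` restricted to `L_ℂ`. -/
def ip (z w : P.LC) : ℂ := M.form (z : CVec n) (w : CVec n)

/-- The imaginary part `Im z`, a real vector of `L_ℂ`. -/
def imag (z : P.LC) : P.LC := (2 * Complex.I)⁻¹ • (z - P.bar z)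

/-- `φ̃(z) = -½ ⟨z, z⟩ e + z + f`. -/
def phi (z : P.LC) : CVec n :=
  (-(1 / 2 : ℂ) * P.ip z z) • realVec P.e + (z : CVec n) + realVec P.f

/-- The derivative of `φ̃` at `z` in the direction `a`. -/
def dphi (z a : P.LC) : CVec n := (-P.ip z a) • realVec P.e + (a : CVec n)

lemma form_e_LC (z : P.LC) : M.form (realVec P.e) z = 0 := by
  have h := z.2
  simp only [LC, Submodule.mem_inf, LinearMap.mem_ker] at h
  exact h.1

lemma form_f_LC (z : P.LC) : M.form (realVec P.f) z = 0 := by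
  have h := z.2
  simp only [LC, Submodule.mem_inf, LinearMap.mem_ker] at h
  exact h.2

lemma dphi_mem (z a : P.LC) : P.dphi z a ∈ M.perp (P.phi z) := by
  have h₁ := P.form_e_LC a
  have h₂ := P.form_f_LC a
  have h₃ := P.form_e_LC z
  rw [M.form_comm] at h₃
  have h₄ := P.ef
  rw [M.form_comm] at h₄
  simp [phi, dphi, ip, h₁, h₂, h₃, h₄, P.ee]

lemma form_phi_self (z : P.LC) : M.form (P.phi z) (P.phi z) = 0 := by
  have h₁ := P.form_e_LC z
  have h₂ := P.form_f_LC z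
  have h₃ := h₁
  rw [M.form_comm] at h₃
  have h₅ := h₂
  rw [M.form_comm] at h₅
  have h₄ := P.ef
  rw [M.form_comm] at h₄
  simp [phi, ip, h₁, h₂, h₃, h₄, h₅, P.ee, P.ff, P.ef]
  ring

/-- The tube domain `𝓒 ⊆ L_ℂ`: the component of `{z : ⟨Im z, Im z⟩ > 0}` that is mapped to `𝓓` by
`φ̃`, written as the preimage of `Aff(𝓓)`
(note that `⟨φ̃(z), φ̃(z)⟩ = 0` and `⟨φ̃(z), conj φ̃(z)⟩ = 2 ⟨Im z, Im z⟩`). -/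
def tube (Z₀ : CVec n) : Set P.LC := {z | P.phi z ∈ M.aff Z₀}

lemma continuous_phi : Continuous P.phi := by
  have h : Continuous fun z : P.LC => P.ip z z := by
    simp only [ip, form_apply]
    refine continuous_finsetSum _ fun i _ => continuous_finsetSum _ fun j _ => ?_
    exact (((continuous_apply i).comp continuous_subtype_val).mul continuous_const).mul
      ((continuous_apply j).comp continuous_subtype_val)
  unfold phi
  fun_prop

lemma isOpen_tube (Z₀ : CVec n) : IsOpen (P.tube Z₀) := by
  have hopen : IsOpen (P.phi ⁻¹' M.cone) := by
    have : P.phi ⁻¹' M.cone = {z | 0 < (M.form (P.phi z) (star (P.phi z))).re} := by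
      ext z
      simp [cone, P.form_phi_self]
    rw [this]
    refine isOpen_lt continuous_const ?_
    have := P.continuous_phi
    simp only [form_apply]
    fun_prop
  rw [Metric.isOpen_iff] at hopen ⊢
  intro z hz
  have hzc : P.phi z ∈ M.cone := connectedComponentIn_subset _ _ hz
  obtain ⟨r, hr, hb⟩ := hopen z hzc
  refine ⟨r, hr, fun w hw => ?_⟩
  let _ : NormedSpace ℝ P.LC := inferInstance
  have hpre : IsPreconnected (P.phi '' Metric.ball z r) :=
    ((convex_ball z r).isPreconnected).image _ P.continuous_phi.continuousOn
  have hsub := hpre.subset_connectedComponentIn (x := P.phi z)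
    ⟨z, Metric.mem_ball_self hr, rfl⟩ (Set.image_subset_iff.2 hb)
  have heq : connectedComponentIn M.cone Z₀ = connectedComponentIn M.cone (P.phi z) :=
    connectedComponentIn_eq hz
  change P.phi w ∈ connectedComponentIn M.cone Z₀
  rw [heq]
  exact hsub ⟨w, hw, rfl⟩

open Classical in
/-- The section `F` in the trivialisation of `𝓛` by `φ̃` and of `𝓔` by `dφ̃ : L_ℂ ≅ 𝓔`:
the tensor `F(z)(a₁, …, a_s) = F_{φ̃(z)}(dφ̃(a₁), …, dφ̃(a_s))`
on the tube domain (extended by `0`). -/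
def pull {Z₀ : CVec n} {s : ℕ} (F : M.HodgeSection Z₀ s) (z : P.LC) (a : Fin s → P.LC) : ℂ :=
  if h : P.phi z ∈ M.aff Z₀ then
    F ⟨P.phi z, h⟩ (fun i => M.hodgeMk (P.phi z) (P.dphi z (a i)) (P.dphi_mem z (a i)))
  else 0

/-! ### The lowering operator and almost-holomorphic tensors -/

/-- `∂̄ T` at `z`, evaluated on the antiholomorphic part of the real tangent vector `v`:
the derivative `Σ_b (∂T/∂z̄_b) · conj(v_b)`. -/
def dbar (T : P.LC → ℂ) (z v : P.LC) : ℂ :=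
  (1 / 2 : ℂ) * (fderiv ℝ T z v + Complex.I * fderiv ℝ T z (Complex.I • v))

/-- The lowering operator on tensors on the tube domain,
`L(T)(z)(a₁, …, a_s, a) = Σ_b (∂T(a₁, …, a_s)/∂z̄_b) · c_b`, where
`c = ⟨y, y⟩ a - 2 ⟨a, y⟩ y` and `y = Im z`. -/
def lower {s : ℕ} (T : P.LC → (Fin s → P.LC) → ℂ) (z : P.LC) (a : Fin (s + 1) → P.LC) : ℂ :=
  P.dbar (fun w => T w (Fin.init a)) z
    (P.ip (P.imag z) (P.imag z) • P.bar (a (Fin.last s)) -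
      (2 * P.ip (P.bar (a (Fin.last s))) (P.imag z)) • P.imag z)

/-- The iterated lowering operator `L^d`. -/
def lowerIter {s : ℕ} (T : P.LC → (Fin s → P.LC) → ℂ) :
    (d : ℕ) → P.LC → (Fin (s + d) → P.LC) → ℂ
  | 0 => T
  | d + 1 => P.lower (lowerIter T d)

/-- The vector of `L_ℂ` dual to `ν(z) = ∂ log ⟨Im z, Im z⟩`. As
`ν_j(z) = -i ⟨Im z, e_j⟩ / ⟨Im z, Im z⟩`, it is `-i Im z / ⟨Im z, Im z⟩`. -/
def nu (z : P.LC) : P.LC := (-Complex.I / P.ip (P.imag z) (P.imag z)) • P.imag z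

/-- `T` is a polynomial in `ν` with holomorphic coefficients,
`T(z)(a₁, …, a_s) = Σ_{t ≤ d} c_t(z)(a₁, …, a_s, ν(z), …, ν(z))`, and `f = c₀` is its
value at `ν = 0`. -/
def HasConstantTerm (Z₀ : CVec n) {s : ℕ} (T : P.LC → (Fin s → P.LC) → ℂ)
    (f : P.tube Z₀ → MultilinearMap ℂ (fun _ : Fin s => P.LC) ℂ) : Prop :=
  ∃ (d : ℕ) (c : (t : ℕ) → P.LC → MultilinearMap ℂ (fun _ : Fin (s + t) => P.LC) ℂ),
    (∀ t a, DifferentiableOn ℂ (fun z => c t z a) (P.tube Z₀)) ∧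
    (∀ z ∈ P.tube Z₀, ∀ a, T z a =
      ∑ t ∈ Finset.range (d + 1), c t z (Fin.append a (fun _ : Fin t => P.nu z))) ∧
    ∀ z : P.tube Z₀, f z = c 0 z

lemma contDiff_coord (i : Fin (n + 2)) : ContDiff ℝ ∞ fun z : P.LC => (z : CVec n) i :=
  ((((ContinuousLinearMap.proj i : CVec n →L[ℂ] ℂ)).comp P.LC.subtypeL).restrictScalars
    ℝ).contDiff

lemma contDiff_bar : ContDiff ℝ ∞ P.bar := by
  let l : P.LC →ₗ[ℝ] P.LC :=
    { toFun := P.bar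
      map_add' := fun x y => by ext i; simp [bar]
      map_smul' := fun c x => by ext i; simp [bar] }
  exact (LinearMap.toContinuousLinearMap l).contDiff

lemma contDiff_imag : ContDiff ℝ ∞ P.imag :=
  (contDiff_id.sub P.contDiff_bar).const_smul _

lemma contDiff_ip {f g : P.LC → P.LC} (hf : ContDiff ℝ ∞ f) (hg : ContDiff ℝ ∞ g) :
    ContDiff ℝ ∞ fun z => P.ip (f z) (g z) := by
  simp only [ip, form_apply]
  refine ContDiff.sum fun i _ => ContDiff.sum fun j _ => ?_
  exact (((P.contDiff_coord i).comp hf).mul contDiff_const).mul ((P.contDiff_coord j).comp hg)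

lemma lower_smooth (Z₀ : CVec n) {s : ℕ} {T : P.LC → (Fin s → P.LC) → ℂ}
    (hT : ∀ a, ContDiffOn ℝ ∞ (fun z => T z a) (P.tube Z₀)) (a : Fin (s + 1) → P.LC) :
    ContDiffOn ℝ ∞ (fun z => P.lower T z a) (P.tube Z₀) := by
  have hv : ContDiff ℝ ∞ fun z : P.LC =>
      P.ip (P.imag z) (P.imag z) • P.bar (a (Fin.last s)) -
        (2 * P.ip (P.bar (a (Fin.last s))) (P.imag z)) • P.imag z :=
    ((P.contDiff_ip P.contDiff_imag P.contDiff_imag).smul contDiff_const).sub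
      ((contDiff_const.mul (P.contDiff_ip contDiff_const P.contDiff_imag)).smul
        P.contDiff_imag)
  have hd := (hT (Fin.init a)).fderiv_of_isOpen (m := ∞) (P.isOpen_tube Z₀) (by simp)
  exact contDiffOn_const.mul ((hd.clm_apply hv.contDiffOn).add
    (contDiffOn_const.mul (hd.clm_apply (hv.const_smul Complex.I).contDiffOn)))

lemma lowerIter_smooth (Z₀ : CVec n) {s : ℕ} {T : P.LC → (Fin s → P.LC) → ℂ}
    (hT : ∀ a, ContDiffOn ℝ ∞ (fun z => T z a) (P.tube Z₀)) (d : ℕ) :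
    ∀ a, ContDiffOn ℝ ∞ (fun z => P.lowerIter T d z a) (P.tube Z₀) := by
  induction d with
  | zero => exact hT
  | succ d ih => exact fun a => P.lower_smooth Z₀ ih a

lemma dbar_congr {Z₀ : CVec n} {T T' : P.LC → ℂ} {z : P.LC} (hz : z ∈ P.tube Z₀)
    (h : ∀ w ∈ P.tube Z₀, T w = T' w) (v : P.LC) : P.dbar T z v = P.dbar T' z v := by
  have he : T =ᶠ[nhds z] T' := by
    filter_upwards [(P.isOpen_tube Z₀).mem_nhds hz] with w hw using h w hw
  simp only [dbar, he.fderiv_eq]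

lemma dbar_comb {Z₀ : CVec n} {T₁ T₂ : P.LC → ℂ} {z : P.LC} (hz : z ∈ P.tube Z₀)
    (h₁ : ContDiffOn ℝ ∞ T₁ (P.tube Z₀)) (h₂ : ContDiffOn ℝ ∞ T₂ (P.tube Z₀)) (c : ℂ)
    (v : P.LC) :
    P.dbar (fun w => c * T₁ w + T₂ w) z v = c * P.dbar T₁ z v + P.dbar T₂ z v := by
  have ho := (P.isOpen_tube Z₀).mem_nhds hz
  have d₁ : DifferentiableAt ℝ T₁ z := (h₁.contDiffAt ho).differentiableAt (by simp)
  have d₂ : DifferentiableAt ℝ T₂ z := (h₂.contDiffAt ho).differentiableAt (by simp)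
  have : fderiv ℝ (fun w => c * T₁ w + T₂ w) z = c • fderiv ℝ T₁ z + fderiv ℝ T₂ z :=
    ((d₁.hasFDerivAt.const_mul c).add d₂.hasFDerivAt).fderiv
  simp only [dbar, this, add_apply, smul_apply, smul_eq_mul]
  ring

lemma lowerIter_comb {Z₀ : CVec n} {s : ℕ} {T T₁ T₂ : P.LC → (Fin s → P.LC) → ℂ} (c : ℂ)
    (h₁ : ∀ a, ContDiffOn ℝ ∞ (fun z => T₁ z a) (P.tube Z₀))
    (h₂ : ∀ a, ContDiffOn ℝ ∞ (fun z => T₂ z a) (P.tube Z₀))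
    (h : ∀ z ∈ P.tube Z₀, ∀ a, T z a = c * T₁ z a + T₂ z a) (d : ℕ) :
    ∀ z ∈ P.tube Z₀, ∀ a, P.lowerIter T d z a =
      c * P.lowerIter T₁ d z a + P.lowerIter T₂ d z a := by
  induction d with
  | zero => exact h
  | succ d ih =>
    intro z hz a
    change P.dbar _ z _ = c * P.dbar _ z _ + P.dbar _ z _
    rw [← P.dbar_comb hz (P.lowerIter_smooth Z₀ h₁ d _) (P.lowerIter_smooth Z₀ h₂ d _)]
    exact P.dbar_congr hz (fun w hw => ih w hw _) _

lemma lowerIter_zero {s : ℕ} (d : ℕ) :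
    P.lowerIter (fun _ (_ : Fin s → P.LC) => (0 : ℂ)) d = fun _ _ => 0 := by
  induction d with
  | zero => rfl
  | succ d ih =>
    funext z a
    simp [lowerIter, lower, dbar, ih]

lemma lowerIter_vanish {Z₀ : CVec n} {s : ℕ} {T : P.LC → (Fin s → P.LC) → ℂ} {d e : ℕ}
    (hde : d ≤ e) (h : ∀ z ∈ P.tube Z₀, ∀ a, P.lowerIter T d z a = 0) :
    ∀ z ∈ P.tube Z₀, ∀ a, P.lowerIter T e z a = 0 := by
  induction e, hde using Nat.le_induction with
  | base => exact h
  | succ e _ ih =>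
    intro z hz a
    change P.dbar _ z _ = 0
    rw [P.dbar_congr (T' := fun _ => 0) hz (fun w hw => ih w hw _)]
    simp [dbar]

lemma pull_comb {Z₀ : CVec n} {s : ℕ} (c : ℂ) (F G : M.HodgeSection Z₀ s) (z : P.LC)
    (a : Fin s → P.LC) : P.pull (c • F + G) z a = c * P.pull F z a + P.pull G z a := by
  unfold pull
  split_ifs <;> simp

lemma pull_zero {Z₀ : CVec n} {s : ℕ} :
    P.pull (0 : M.HodgeSection Z₀ s) = fun _ _ => 0 := by
  funext z a
  simp [pull]

lemma HasConstantTerm.zero (Z₀ : CVec n) (s : ℕ) :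
    P.HasConstantTerm Z₀ (fun _ (_ : Fin s → P.LC) => (0 : ℂ)) 0 :=
  ⟨0, fun _ _ => 0, by simp, by simp, by intro z; rfl⟩

lemma HasConstantTerm.comb {P : M.HypPair} {Z₀ : CVec n} {s : ℕ}
    {T T₁ T₂ : P.LC → (Fin s → P.LC) → ℂ}
    {f₁ f₂ : P.tube Z₀ → MultilinearMap ℂ (fun _ : Fin s => P.LC) ℂ} (c : ℂ)
    (h₁ : P.HasConstantTerm Z₀ T₁ f₁) (h₂ : P.HasConstantTerm Z₀ T₂ f₂)
    (h : ∀ z ∈ P.tube Z₀, ∀ a, T z a = c * T₁ z a + T₂ z a) :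
    P.HasConstantTerm Z₀ T (c • f₁ + f₂) := by
  obtain ⟨d₁, c₁, hol₁, exp₁, ct₁⟩ := h₁
  obtain ⟨d₂, c₂, hol₂, exp₂, ct₂⟩ := h₂
  refine ⟨max d₁ d₂, fun t z => (if t < d₁ + 1 then c • c₁ t z else 0) +
    (if t < d₂ + 1 then c₂ t z else 0), fun t a => ?_, fun z hz a => ?_, fun z => ?_⟩
  · have e₁ := (hol₁ t a).const_mul c
    have e₂ := hol₂ t a
    by_cases l₁ : t < d₁ + 1 <;> by_cases l₂ : t < d₂ + 1
    · simp only [if_pos l₁, if_pos l₂]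
      exact e₁.add e₂
    · simp only [if_pos l₁, if_neg l₂, add_zero]
      exact e₁
    · simp only [if_neg l₁, if_pos l₂, zero_add]
      exact e₂
    · simp only [if_neg l₁, if_neg l₂, zero_add]
      exact differentiableOn_const 0
  · have key : ∀ (m k : ℕ), m ≤ k → ∀ g : ℕ → ℂ,
        ∑ t ∈ Finset.range (m + 1), g t =
          ∑ t ∈ Finset.range (k + 1), if t < m + 1 then g t else 0 := by
      intro m k hmk g
      rw [← Finset.sum_filter]
      refine Finset.sum_congr ?_ fun _ _ => rfl
      ext t
      simp only [Finset.mem_range, Finset.mem_filter]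
      omega
    rw [h z hz a, exp₁ z hz a, exp₂ z hz a, key d₁ _ (le_max_left d₁ d₂),
      key d₂ _ (le_max_right d₁ d₂), Finset.mul_sum, ← Finset.sum_add_distrib]
    refine Finset.sum_congr rfl fun t _ => ?_
    by_cases l₁ : t < d₁ + 1 <;> by_cases l₂ : t < d₂ + 1 <;>
      simp only [if_pos, if_neg, l₁, l₂, not_false_eq_true, add_apply,
        smul_apply, smul_eq_mul, zero_apply, mul_zero, zero_add]
  · simp only [Nat.zero_lt_succ, if_true, Pi.add_apply, Pi.smul_apply, ct₁ z, ct₂ z]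

/-! ### The condition at the cusps -/

variable {Z₀ : CVec n} (Γ : Subgroup (M.OPlus Z₀))

/-- `U(Γ) = {ξ ∈ L : exp(ξ ∧ e) ∈ Γ}`, where `exp(ξ ∧ e)` is the Eichler transvection
`x ↦ x + ⟨e, x⟩ ξ - ⟨ξ, x⟩ e - ½ ⟨ξ, ξ⟩ ⟨e, x⟩ e`, acting on the tube domain by `z ↦ z + ξ`. -/
def transl : Set P.LC :=
  {ξ | ∃ γ ∈ Γ, ∀ x : CVec n, act (γ : GL (Fin (n + 2)) ℤ) x =
    x + M.form (realVec P.e) x • (ξ : CVec n) - M.form (ξ : CVec n) x • realVec P.e -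
      ((1 / 2 : ℂ) * P.ip ξ ξ * M.form (realVec P.e) x) • realVec P.e}

/-- The dual lattice `U(Γ)^∨`, embedded in `L_ℂ` by the form. -/
def translDual : Set P.LC := {α | ∀ ξ ∈ P.transl Γ, ∃ m : ℤ, P.ip α ξ = m}

/-- `f` has a Fourier expansion `Σ_{α ∈ U(Γ)^∨} c_α e^{2πi ⟨α, z⟩}` in which `c_α ≠ 0` only for
`α` in the closure of the positive cone `{Im z : z ∈ 𝓒}`. -/
def FourierRegular {s : ℕ}
    (f : P.tube Z₀ → MultilinearMap ℂ (fun _ : Fin s => P.LC) ℂ) : Prop :=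
  ∃ c : P.translDual Γ → MultilinearMap ℂ (fun _ : Fin s => P.LC) ℂ,
    (∀ α, c α ≠ 0 → (α : P.LC) ∈ closure (P.imag '' P.tube Z₀)) ∧
    ∀ (z : P.tube Z₀) a, HasSum (fun α : P.translDual Γ =>
      c α a * Complex.exp (2 * Real.pi * Complex.I * P.ip α (z : P.LC))) (f z a)

lemma FourierRegular.zero (s : ℕ) :
    P.FourierRegular Γ (s := s) 0 :=
  ⟨0, fun α h => absurd rfl h, fun z a => by simp⟩

lemma FourierRegular.comb {P : M.HypPair} {Γ : Subgroup (M.OPlus Z₀)} {s : ℕ}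
    {f₁ f₂ : P.tube Z₀ → MultilinearMap ℂ (fun _ : Fin s => P.LC) ℂ} (c : ℂ)
    (h₁ : P.FourierRegular Γ f₁) (h₂ : P.FourierRegular Γ f₂) :
    P.FourierRegular Γ (c • f₁ + f₂) := by
  obtain ⟨c₁, s₁, e₁⟩ := h₁
  obtain ⟨c₂, s₂, e₂⟩ := h₂
  refine ⟨c • c₁ + c₂, fun α h => ?_, fun z a => ?_⟩
  · by_contra hα
    have z₁ : c₁ α = 0 := by
      by_contra h'
      exact hα (s₁ α h')
    have z₂ : c₂ α = 0 := by
      by_contra h'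
      exact hα (s₂ α h')
    exact h (by simp [z₁, z₂])
  · have := ((e₁ z a).mul_left c).add (e₂ z a)
    simpa [add_mul, mul_assoc] using this

end HypPair

/-! ### Almost-holomorphic modular forms and quasimodular forms -/

variable {Z₀ : CVec n}

/-- `F` is smooth (in all the global charts of `𝓓` given by tube domains). -/
def IsSmooth {s : ℕ} (F : M.HodgeSection Z₀ s) : Prop :=
  ∀ (P : M.HypPair) (a : Fin s → P.LC), ContDiffOn ℝ ∞ (fun z => P.pull F z a) (P.tube Z₀)

/-- `L^{d+1}(F) = 0` for some `d`. -/
def IsAlmostHolomorphic {s : ℕ} (F : M.HodgeSection Z₀ s) : Prop :=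
  ∃ d : ℕ, ∀ (P : M.HypPair), ∀ z ∈ P.tube Z₀, ∀ a,
    P.lowerIter (P.pull F) (d + 1) z a = 0

/-- At every zero-dimensional cusp and for all `d`, the constant term of `L^d(F)` has a Fourier
expansion supported on the closure of the positive cone. -/
def IsRegularAtCusps (Γ : Subgroup (M.OPlus Z₀)) {s : ℕ} (F : M.HodgeSection Z₀ s) : Prop :=
  ∀ (P : M.HypPair), P.IsRational → ∀ d : ℕ,
    ∃ f, P.HasConstantTerm Z₀ (P.lowerIter (P.pull F) d) f ∧ P.FourierRegular Γ f

/-- Almost-holomorphic modular forms of weight `k` and rank `s` for `Γ`: the `Γ`-invariant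
almost-holomorphic smooth sections of `𝓛^k ⊗ 𝓔^{⊗ s}`, with a condition at the cusps if
`n ≤ 2`. -/
structure IsAHMod (k : ℤ) (Γ : Subgroup (M.OPlus Z₀)) {s : ℕ} (F : M.HodgeSection Z₀ s) :
    Prop where
  homog : IsHomog k F
  smooth : IsSmooth F
  invariant : ∀ γ ∈ Γ, IsInvariant (γ : GL (Fin (n + 2)) ℤ) F
  almostHolomorphic : IsAlmostHolomorphic F
  cusps : n ≤ 2 → IsRegularAtCusps Γ F

lemma IsAHMod.zero (k : ℤ) (Γ : Subgroup (M.OPlus Z₀)) (s : ℕ) :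
    IsAHMod k Γ (0 : M.HodgeSection Z₀ s) where
  homog := by intro Z Z' c _ u hu hu'; simp
  smooth := by
    intro P a
    rw [P.pull_zero]
    exact contDiffOn_const
  invariant := by intro γ _ Z Z' _ u hu hu'; simp
  almostHolomorphic := ⟨0, fun P z _ a => by rw [P.pull_zero, P.lowerIter_zero]⟩
  cusps := fun _ P _ d => ⟨0, by
    rw [P.pull_zero, P.lowerIter_zero]
    exact HypPair.HasConstantTerm.zero P Z₀ (s + d), HypPair.FourierRegular.zero P Γ _⟩

lemma IsAHMod.comb {k : ℤ} {Γ : Subgroup (M.OPlus Z₀)} {s : ℕ} {F G : M.HodgeSection Z₀ s}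
    (hF : IsAHMod k Γ F) (hG : IsAHMod k Γ G) (c : ℂ) : IsAHMod k Γ (c • F + G) where
  homog := by
    intro Z Z' b h u hu hu'
    simp only [Pi.add_apply, Pi.smul_apply, add_apply, smul_apply,
      hF.homog Z Z' b h u hu hu', hG.homog Z Z' b h u hu hu', smul_eq_mul]
    ring
  smooth := by
    intro P a
    simp only [P.pull_comb]
    exact (contDiffOn_const.mul (hF.smooth P a)).add (hG.smooth P a)
  invariant := by
    intro γ hγ Z Z' h u hu hu'
    simp only [Pi.add_apply, Pi.smul_apply, add_apply, smul_apply,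
      hF.invariant γ hγ Z Z' h u hu hu', hG.invariant γ hγ Z Z' h u hu hu']
  almostHolomorphic := by
    obtain ⟨d₁, h₁⟩ := hF.almostHolomorphic
    obtain ⟨d₂, h₂⟩ := hG.almostHolomorphic
    refine ⟨max d₁ d₂, fun P z hz a => ?_⟩
    rw [P.lowerIter_comb c (hF.smooth P) (hG.smooth P) (fun z _ a => P.pull_comb c F G z a) _ z hz,
      P.lowerIter_vanish (Nat.succ_le_succ (le_max_left d₁ d₂)) (h₁ P) z hz,
      P.lowerIter_vanish (Nat.succ_le_succ (le_max_right d₁ d₂)) (h₂ P) z hz]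
    simp
  cusps := by
    intro hn P hP d
    obtain ⟨f₁, t₁, r₁⟩ := hF.cusps hn P hP d
    obtain ⟨f₂, t₂, r₂⟩ := hG.cusps hn P hP d
    exact ⟨c • f₁ + f₂, t₁.comb c t₂
      (P.lowerIter_comb c (hF.smooth P) (hG.smooth P) (fun z _ a => P.pull_comb c F G z a) d),
      r₁.comb c r₂⟩

/-- The complex vector space `AHMod_{k,s}(Γ)`. -/
def AHMod (k : ℤ) (s : ℕ) (Γ : Subgroup (M.OPlus Z₀)) : Submodule ℂ (M.HodgeSection Z₀ s) where
  carrier := {F | IsAHMod k Γ F}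
  zero_mem' := IsAHMod.zero k Γ s
  add_mem' := fun {F G} hF hG => by simpa using hF.comb hG 1
  smul_mem' := fun c F hF => by simpa using hF.comb (IsAHMod.zero k Γ s) c

namespace HypPair

/-- `f` is the value at `ν = 0` of `F`, written as a polynomial in `ν` on the tube domain of `P`. -/
def IsConstantTerm (P : M.HypPair) {s : ℕ} (F : M.HodgeSection Z₀ s)
    (f : P.tube Z₀ → MultilinearMap ℂ (fun _ : Fin s => P.LC) ℂ) : Prop :=
  P.HasConstantTerm Z₀ (P.pull F) f

/-- The complex vector space `QMod_{k,s}(Γ)` of quasimodular forms on the tube domain of `P`: the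
constant terms of the almost-holomorphic modular forms. -/
def QMod (P : M.HypPair) (k : ℤ) (s : ℕ) (Γ : Subgroup (M.OPlus Z₀)) :
    Submodule ℂ (P.tube Z₀ → MultilinearMap ℂ (fun _ : Fin s => P.LC) ℂ) where
  carrier := {f | ∃ F ∈ AHMod k s Γ, P.IsConstantTerm F f}
  zero_mem' := ⟨0, Submodule.zero_mem _, by
    unfold IsConstantTerm
    rw [P.pull_zero]
    exact HasConstantTerm.zero P Z₀ s⟩
  add_mem' := by
    rintro f g ⟨F, hF, hf⟩ ⟨G, hG, hg⟩
    refine ⟨F + G, Submodule.add_mem _ hF hG, ?_⟩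
    have := HasConstantTerm.comb 1 hf hg (fun z _ a => P.pull_comb 1 F G z a)
    simpa [IsConstantTerm] using this
  smul_mem' := by
    rintro c f ⟨F, hF, hf⟩
    refine ⟨c • F, Submodule.smul_mem _ c hF, ?_⟩
    have h0 : P.HasConstantTerm Z₀ (P.pull (0 : M.HodgeSection Z₀ s)) 0 := by
      rw [P.pull_zero]
      exact HasConstantTerm.zero P Z₀ s
    have := HasConstantTerm.comb c hf h0 (fun z _ a => P.pull_comb c F 0 z a)
    simpa [IsConstantTerm] using this

end HypPair

end OrthLattice

end

/-!
The map `F ↦ F|_{ν = 0}` is onto `QMod` by definition, so three things have to be shown: constant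
terms exist, they are unique, and they determine the form.

*Existence.* The lowering operator satisfies `L(ν) = ½ id` (`dbar_comp_nu`), so it acts on
polynomials in `ν` with holomorphic coefficients as `½ ∂/∂ν`. Lowering operators in different
directions commute (`dbar_lowerDir_comm`), hence `L^d F` is symmetric in its last `d` arguments.
If `L^{d+1} F = 0`, then `S = L^d F` is holomorphic, and `F - (2^d / d!) S(·, ν, …, ν)` is
annihilated by `L^d`; induction on `d` gives the expansion (`exists_hasConstantTerm`).

*Uniqueness.* If `Q(z, x)` is a polynomial in `x` with holomorphic coefficients and
`Q(z, ν(z)) = 0`, repeated application of the lowering operator shows that all derivatives of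
`Q(z, ·)` vanish at `ν(z)`, so `Q = 0` (`eq_zero_of_comp_nu_eq_zero`).

*Injectivity.* Let `p_z(ν)` be the expansion of `F`, with `p_z(0) = 0` for all `z`. For `ξ ∈ L` the
Eichler transvection `exp(2ξ ∧ f)` lies in `O⁺(M)`, and `ν` transforms under it by
`ν ↦ ν - ∂ log j` up to a linear map, `j` being the automorphy factor (`nu_moebius`). By uniqueness
the invariance of `F` is an identity between polynomials in `ν`, and its value at `ν = ∂ log j` is
`p_z(∂ log j_ξ(z)) = 0`. After clearing denominators this is polynomial in `ξ`. It holds for a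
multiple of every `ξ ∈ L`, as `Γ` has finite index, so it holds for every `ξ ∈ L_ℂ`. For
`ξ = 2 z̄ / ⟨z̄, z̄⟩` one has `∂ log j_ξ(z) = ν(z)`, and therefore `F(z) = p_z(ν(z)) = 0`
(`pull_eq_zero_of_constantTerm_eq_zero`).
The signature of `M` enters through `⟨e, Z⟩ ≠ 0` and `⟨f, Z⟩ ≠ 0` on the affine cone
(`form_realVec_ne_zero`).
-/

/-! ### Multilinear forms with varying arguments -/

section Multilinear

variable {V ι : Type*} [AddCommGroup V] [Module ℂ V] [Fintype ι]

lemma MultilinearMap.eq_sum_basis {N : ℕ} (b : Module.Basis ι ℂ V)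
    (m : MultilinearMap ℂ (fun _ : Fin N => V) ℂ) (v : Fin N → V) :
    m v = ∑ r : Fin N → ι, (∏ i, b.repr (v i) (r i)) * m (fun i => b (r i)) := by
  classical
  conv_lhs => rw [show v = fun i => ∑ j, b.repr (v i) j • b j from
    funext fun i => (b.sum_repr (v i)).symm]
  rw [MultilinearMap.map_sum]
  exact Finset.sum_congr rfl fun r _ => by rw [MultilinearMap.map_smul_univ, smul_eq_mul]

end Multilinear

section MultilinearCalculus

variable {V E : Type*} [NormedAddCommGroup V] [NormedSpace ℂ V] [FiniteDimensional ℂ V]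
  [NormedAddCommGroup E]

/-- Multilinear forms depending holomorphically on a parameter, evaluated at holomorphically
varying arguments. -/
lemma DifferentiableOn.multilinear_apply [NormedSpace ℂ E] {N : ℕ} {U : Set E}
    {C : E → MultilinearMap ℂ (fun _ : Fin N => V) ℂ} {v : E → Fin N → V}
    (hC : ∀ a, DifferentiableOn ℂ (fun x => C x a) U)
    (hv : ∀ i, DifferentiableOn ℂ (fun x => v x i) U) :
    DifferentiableOn ℂ (fun x => C x (v x)) U := by
  let b := Module.finBasis ℂ V
  simp only [fun x => (C x).eq_sum_basis b (v x)]
  refine DifferentiableOn.fun_sum fun r _ => DifferentiableOn.mul ?_ (hC _)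
  have hd : ∀ i, DifferentiableOn ℂ (fun x => b.repr (v x i) (r i)) U := fun i =>
    (LinearMap.toContinuousLinearMap (b.coord (r i))).differentiable.comp_differentiableOn (hv i)
  intro x hx
  exact (HasFDerivWithinAt.finsetProd fun i _ =>
    (hd i x hx).hasFDerivWithinAt).differentiableWithinAt

lemma ContDiffOn.multilinear_apply [NormedSpace ℝ E] {N : ℕ} {U : Set E}
    {C : E → MultilinearMap ℂ (fun _ : Fin N => V) ℂ} {v : E → Fin N → V}
    (hC : ∀ a, ContDiffOn ℝ ∞ (fun x => C x a) U)
    (hv : ∀ i, ContDiffOn ℝ ∞ (fun x => v x i) U) :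
    ContDiffOn ℝ ∞ (fun x => C x (v x)) U := by
  let b := Module.finBasis ℂ V
  simp only [fun x => (C x).eq_sum_basis b (v x)]
  refine ContDiffOn.sum fun r _ => ContDiffOn.mul ?_ (hC _)
  refine contDiffOn_prod fun i _ => ?_
  have := ((LinearMap.toContinuousLinearMap (b.coord (r i))).restrictScalars
    ℝ).contDiff.comp_contDiffOn (hv i)
  exact this

/-- The `N`-tuple whose first entries are those of `a`, all further entries being `x`. Unlike
`Fin.append`, it leaves the number of repetitions of `x` implicit, which avoids casts between
`Fin (s + (j + 1))` and `Fin (s + j + 1)` in inductions on the number of entries of `a`. -/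
def fillWith {V : Type*} {m N : ℕ} (a : Fin m → V) (x : V) : Fin N → V :=
  fun i => if h : (i : ℕ) < m then a ⟨i, h⟩ else x

lemma fillWith_eq_append {V : Type*} {s t : ℕ} (a : Fin s → V) (x : V) :
    (fillWith a x : Fin (s + t) → V) = Fin.append a (fun _ : Fin t => x) := by
  funext i
  refine Fin.addCases (fun i => ?_) (fun i => ?_) i <;> simp [fillWith]

lemma fillWith_self {V : Type*} {m : ℕ} (a : Fin m → V) (x : V) :
    (fillWith a x : Fin m → V) = a := by
  funext i
  simp [fillWith]

lemma fillWith_update {V : Type*} {s d : ℕ} [DecidableEq (Fin s)] (a : Fin s → V) (x y : V)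
    (i : Fin s) : (fillWith (Function.update a i y) x : Fin (s + d) → V) =
      Function.update (fillWith a x) (Fin.castAdd d i) y := by
  funext k
  by_cases hk : k = Fin.castAdd d i
  · subst hk
    simp [fillWith]
  · rw [Function.update_of_ne hk]
    by_cases h : (k : ℕ) < s
    · have : (⟨k, h⟩ : Fin s) ≠ i := fun e => hk (Fin.ext (by simp [← e]))
      simp [fillWith, h, this]
    · simp [fillWith, h]

lemma update_fillWith {V : Type*} {m N : ℕ} (a : Fin (m + 1) → V) (x : V) (i : Fin N)
    (hi : m ≤ (i : ℕ)) :
    Function.update (fillWith (Fin.init a : Fin m → V) x : Fin N → V) i (a (Fin.last m)) =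
      (fillWith a x : Fin N → V) ∘ Equiv.swap i ⟨m, hi.trans_lt i.2⟩ := by
  funext k
  have hN := i.2
  rw [Function.comp_apply, Equiv.swap_apply_def]
  by_cases hk : k = i
  · subst hk
    simp [fillWith, Fin.last]
  · rw [Function.update_of_ne hk, if_neg hk]
    by_cases hm : k = ⟨m, hi.trans_lt i.2⟩
    · have him : ¬ (i : ℕ) < m + 1 := by
        intro h
        apply hk
        rw [hm]
        ext
        simp
        omega
      rw [if_pos hm]
      simp [fillWith, hm, him]
    · rw [if_neg hm]
      have hkm : (k : ℕ) ≠ m := fun h => hm (Fin.ext h)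
      by_cases hlt : (k : ℕ) < m
      · simp [fillWith, hlt, hlt.trans (Nat.lt_succ_self m), Fin.init]
      · have : ¬ (k : ℕ) < m + 1 := by omega
        simp [fillWith, hlt, this]

lemma fderiv_map_fillWith {m N : ℕ} (f : MultilinearMap ℂ (fun _ : Fin N => V) ℂ)
    (a : Fin m → V) (x : V) :
    DifferentiableAt ℂ (fun x => f (fillWith a x)) x ∧ ∀ y, fderiv ℂ (fun x => f (fillWith a x)) x y =
      ∑ i : Fin N, if (i : ℕ) < m then 0 else f (Function.update (fillWith a x) i y) := by
  have hfc : Continuous f := by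
    rw [← continuousOn_univ]
    exact (DifferentiableOn.multilinear_apply (C := fun _ => f) (v := fun x => x)
      (fun a => differentiableOn_const _) fun i => by fun_prop).continuousOn
  let g : ContinuousMultilinearMap ℂ (fun _ : Fin N => V) ℂ := ⟨f, hfc⟩
  let l : V →L[ℂ] (Fin N → V) := ContinuousLinearMap.pi fun i =>
    if (i : ℕ) < m then 0 else ContinuousLinearMap.id ℂ V
  have hl : HasFDerivAt (fun x => (fillWith a x : Fin N → V)) l x := by
    rw [hasFDerivAt_pi']
    intro i
    by_cases h : (i : ℕ) < m
    · have : (ContinuousLinearMap.proj i).comp l = (0 : V →L[ℂ] V) := by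
        ext y; simp [l, h]
      rw [this]
      simpa only [fillWith, h, dif_pos] using hasFDerivAt_const (𝕜 := ℂ) (a ⟨i, h⟩) x
    · have : (ContinuousLinearMap.proj i).comp l = ContinuousLinearMap.id ℂ V := by
        ext y; simp [l, h]
      rw [this]
      simp only [fillWith, h, dif_neg, not_false_eq_true]
      exact hasFDerivAt_id (𝕜 := ℂ) x
  have key : HasFDerivAt (fun x => f (fillWith a x)) ((g.linearDeriv (fillWith a x)).comp l) x :=
    (g.hasFDerivAt (fillWith a x)).comp x hl
  refine ⟨key.differentiableAt, fun y => ?_⟩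
  rw [key.fderiv]
  simp only [ContinuousLinearMap.comp_apply, ContinuousMultilinearMap.linearDeriv_apply]
  refine Finset.sum_congr rfl fun i _ => ?_
  change f _ = _
  by_cases h : (i : ℕ) < m
  · rw [if_pos h, show l y i = 0 by simp [l, h]]
    exact f.map_update_zero _ _
  · rw [if_neg h, show l y i = y by simp [l, h]]

end MultilinearCalculus

/-! ### Polynomial functions of one variable -/

/-- `g : ℂ → ℂ` is given by a polynomial. -/
def IsPolyFun (g : ℂ → ℂ) : Prop := ∃ p : Polynomial ℂ, ∀ t, g t = p.eval t

namespace IsPolyFun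

lemma const (c : ℂ) : IsPolyFun fun _ => c := ⟨Polynomial.C c, by simp⟩

lemma id : IsPolyFun fun t => t := ⟨Polynomial.X, by simp⟩

lemma add {g h : ℂ → ℂ} (hg : IsPolyFun g) (hh : IsPolyFun h) : IsPolyFun fun t => g t + h t := by
  obtain ⟨p, hp⟩ := hg
  obtain ⟨q, hq⟩ := hh
  exact ⟨p + q, by simp [hp, hq]⟩

lemma mul {g h : ℂ → ℂ} (hg : IsPolyFun g) (hh : IsPolyFun h) : IsPolyFun fun t => g t * h t := by
  obtain ⟨p, hp⟩ := hg
  obtain ⟨q, hq⟩ := hh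
  exact ⟨p * q, by simp [hp, hq]⟩

lemma pow {g : ℂ → ℂ} (hg : IsPolyFun g) (k : ℕ) : IsPolyFun fun t => g t ^ k := by
  obtain ⟨p, hp⟩ := hg
  exact ⟨p ^ k, by simp [hp]⟩

lemma sum {α : Type*} {s : Finset α} {g : α → ℂ → ℂ} (h : ∀ i ∈ s, IsPolyFun (g i)) :
    IsPolyFun fun t => ∑ i ∈ s, g i t := by
  classical
  induction s using Finset.induction_on with
  | empty => simpa using const 0
  | insert i s hi ih =>
    simp only [Finset.sum_insert hi]
    exact (h i (Finset.mem_insert_self i s)).add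
      (ih fun j hj => h j (Finset.mem_insert_of_mem hj))

lemma prod {α : Type*} {s : Finset α} {g : α → ℂ → ℂ} (h : ∀ i ∈ s, IsPolyFun (g i)) :
    IsPolyFun fun t => ∏ i ∈ s, g i t := by
  classical
  induction s using Finset.induction_on with
  | empty => simpa using const 1
  | insert i s hi ih =>
    simp only [Finset.prod_insert hi]
    exact (h i (Finset.mem_insert_self i s)).mul
      (ih fun j hj => h j (Finset.mem_insert_of_mem hj))

lemma eq_zero {g : ℂ → ℂ} (hg : IsPolyFun g) {S : Set ℂ} (hS : S.Infinite)
    (h : ∀ t ∈ S, g t = 0) (t : ℂ) : g t = 0 := by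
  obtain ⟨p, hp⟩ := hg
  have : p = 0 := Polynomial.eq_zero_of_infinite_isRoot p
    (hS.mono fun t ht => by simpa [hp] using h t ht)
  simp [hp, this]

lemma eq_zero_of_nat_mul {g : ℂ → ℂ} (hg : IsPolyFun g) {N : ℂ} (hN : N ≠ 0)
    (h : ∀ m : ℕ, g (N * m) = 0) (t : ℂ) : g t = 0 := by
  refine hg.eq_zero (S := Set.range fun m : ℕ => N * m) (Set.infinite_range_of_injective ?_) ?_ t
  · intro a b hab
    simpa [hN] using hab
  · rintro _ ⟨m, rfl⟩
    exact h m

lemma quadratic (a b c : ℂ) : IsPolyFun fun t => a + b * t + c * t ^ 2 :=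
  ((const a).add ((const b).mul id)).add ((const c).mul (id.pow 2))

lemma multilinear_apply {V : Type*} [NormedAddCommGroup V] [NormedSpace ℂ V]
    [FiniteDimensional ℂ V] {N : ℕ} (C : MultilinearMap ℂ (fun _ : Fin N => V) ℂ)
    {v : ℂ → Fin N → V} (hv : ∀ i (l : V →ₗ[ℂ] ℂ), IsPolyFun fun t => l (v t i)) :
    IsPolyFun fun t => C (v t) := by
  simp only [fun t => C.eq_sum_basis (Module.finBasis ℂ V) (v t)]
  exact sum fun r _ => (prod fun i _ => hv i ((Module.finBasis ℂ V).coord (r i))).mul (const _)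

/-- A function that is polynomial on every line and vanishes on a subgroup vanishes on the
complex span of the subgroup. -/
lemma eq_zero_of_mem_span {V : Type*} [AddCommGroup V] [Module ℂ V] {g : V → ℂ}
    (hg : ∀ x y, IsPolyFun fun t => g (x + t • y)) (A : AddSubgroup V) (hA : ∀ x ∈ A, g x = 0)
    {v : V} (hv : v ∈ Submodule.span ℂ (A : Set V)) : g v = 0 := by
  -- `Z` consists of the common zeros of all functions polynomial on lines that vanish on `A`.
  let Z : Set V := {x | ∀ h : V → ℂ, (∀ x y, IsPolyFun fun t => h (x + t • y)) →
    (∀ x ∈ A, h x = 0) → h x = 0}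
  -- For `a ∈ A` the translates of such a function by the multiples of `a` are of the same kind, so
  -- on a line in the direction of `a` through a point of `Z` it has infinitely many zeros.
  have key : ∀ c : ℂ, ∀ x ∈ Z, x + c • v ∈ Z := by
    induction hv using Submodule.span_induction with
    | mem a ha =>
      intro c x hx h hh hhA
      refine (hh x a).eq_zero_of_nat_mul (N := 1) one_ne_zero (fun m => ?_) c
      refine hx (fun y => h (y + (1 * (m : ℂ)) • a)) (fun y w => ?_) fun y hy => hhA _ ?_
      · simpa only [add_right_comm] using hh (y + (1 * (m : ℂ)) • a) w
      · rw [one_mul, Nat.cast_smul_eq_nsmul]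
        exact A.add_mem hy (A.nsmul_mem ha m)
    | zero => intro c x hx; simpa using hx
    | add a b _ _ iha ihb =>
      intro c x hx
      rw [smul_add, ← add_assoc]
      exact ihb c _ (iha c x hx)
    | smul d a _ iha =>
      intro c x hx
      rw [smul_smul]
      exact iha _ x hx
  have h0 : (0 : V) ∈ Z := fun h _ hhA => hhA 0 A.zero_mem
  have := key 1 0 h0
  rw [zero_add, one_smul] at this
  exact this g hg hA

end IsPolyFun

/-! ### Polynomials with holomorphic coefficients -/

section HolPoly

variable {V : Type*} [NormedAddCommGroup V] [NormedSpace ℂ V]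

/-- The functions `Q(z, x)` that are polynomial in `x` with coefficients holomorphic in `z ∈ U`:
the algebra generated by the holomorphic functions of `z` and the linear forms in `x`. -/
inductive IsHolPoly (U : Set V) : (V × V → ℂ) → Prop
  | coeff {h : V → ℂ} (hh : DifferentiableOn ℂ h U) : IsHolPoly U fun p => h p.1
  | linear (l : V →L[ℂ] ℂ) : IsHolPoly U fun p => l p.2
  | add {Q R : V × V → ℂ} (hQ : IsHolPoly U Q) (hR : IsHolPoly U R) :
      IsHolPoly U fun p => Q p + R p
  | mul {Q R : V × V → ℂ} (hQ : IsHolPoly U Q) (hR : IsHolPoly U R) :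
      IsHolPoly U fun p => Q p * R p

namespace IsHolPoly

variable {U : Set V} {Q : V × V → ℂ}

lemma const (c : ℂ) : IsHolPoly U fun _ => c := coeff (differentiableOn_const c)

lemma sum {α : Type*} {s : Finset α} {Q : α → V × V → ℂ} (h : ∀ i ∈ s, IsHolPoly U (Q i)) :
    IsHolPoly U fun p => ∑ i ∈ s, Q i p := by
  classical
  induction s using Finset.induction_on with
  | empty => simpa using const 0
  | insert i s hi ih =>
    simp only [Finset.sum_insert hi]
    exact (h i (Finset.mem_insert_self i s)).add
      (ih fun j hj => h j (Finset.mem_insert_of_mem hj))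

lemma prod {α : Type*} {s : Finset α} {Q : α → V × V → ℂ} (h : ∀ i ∈ s, IsHolPoly U (Q i)) :
    IsHolPoly U fun p => ∏ i ∈ s, Q i p := by
  classical
  induction s using Finset.induction_on with
  | empty => simpa using const 1
  | insert i s hi ih =>
    simp only [Finset.prod_insert hi]
    exact (h i (Finset.mem_insert_self i s)).mul
      (ih fun j hj => h j (Finset.mem_insert_of_mem hj))

lemma differentiableOn (hQ : IsHolPoly U Q) : DifferentiableOn ℂ Q (U ×ˢ Set.univ) := by
  induction hQ with
  | coeff hh => exact hh.comp differentiableOn_fst fun p hp => hp.1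
  | linear l => exact (l.differentiable.comp differentiable_snd).differentiableOn
  | add _ _ hQ hR => exact hQ.add hR
  | mul _ _ hQ hR => exact hQ.mul hR

lemma differentiableAt (hQ : IsHolPoly U Q) (hU : IsOpen U) {z : V} (hz : z ∈ U) (x : V) :
    DifferentiableAt ℂ Q (z, x) :=
  (hQ.differentiableOn _ ⟨hz, Set.mem_univ x⟩).differentiableAt
    ((hU.prod isOpen_univ).mem_nhds ⟨hz, Set.mem_univ _⟩)

lemma exists_fderiv (hU : IsOpen U) (hQ : IsHolPoly U Q) (a : V) :
    ∃ R, IsHolPoly U R ∧ ∀ z ∈ U, ∀ x, fderiv ℂ Q (z, x) (0, a) = R (z, x) := by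
  induction hQ with
  | @coeff h hh =>
    refine ⟨_, const 0, fun z hz x => ?_⟩
    have h₁ := ((hh z hz).differentiableAt (hU.mem_nhds hz)).hasFDerivAt
    have h₂ : HasFDerivAt (fun p : V × V => h p.1) _ (z, x) :=
      HasFDerivAt.comp (z, x) (f := Prod.fst) h₁ hasFDerivAt_fst
    rw [h₂.fderiv]
    simp
  | linear l =>
    refine ⟨_, const (l a), fun z hz x => ?_⟩
    have h₂ : HasFDerivAt (fun p : V × V => l p.2) _ (z, x) :=
      HasFDerivAt.comp (z, x) (f := Prod.snd) l.hasFDerivAt hasFDerivAt_snd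
    rw [h₂.fderiv]
    simp
  | add hQ hR ihQ ihR =>
    obtain ⟨Q', hQ', eQ⟩ := ihQ
    obtain ⟨R', hR', eR⟩ := ihR
    refine ⟨_, hQ'.add hR', fun z hz x => ?_⟩
    rw [fderiv_fun_add (hQ.differentiableAt hU hz x) (hR.differentiableAt hU hz x)]
    simp [eQ z hz, eR z hz]
  | mul hQ hR ihQ ihR =>
    obtain ⟨Q', hQ', eQ⟩ := ihQ
    obtain ⟨R', hR', eR⟩ := ihR
    refine ⟨_, (hQ.mul hR').add (hR.mul hQ'), fun z hz x => ?_⟩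
    rw [fderiv_fun_mul (hQ.differentiableAt hU hz x) (hR.differentiableAt hU hz x)]
    simp [eQ z hz, eR z hz]

variable [FiniteDimensional ℂ V]

lemma linear_family {A : V → V →ₗ[ℂ] ℂ} (hA : ∀ b, DifferentiableOn ℂ (fun z => A z b) U) :
    IsHolPoly U fun p => A p.1 p.2 := by
  let b := Module.finBasis ℂ V
  have : (fun p : V × V => A p.1 p.2) = fun p => ∑ i, b.coord i p.2 * A p.1 (b i) := by
    funext p
    conv_lhs => rw [← b.sum_repr p.2, map_sum]
    exact Finset.sum_congr rfl fun i _ => by rw [map_smul, smul_eq_mul, b.coord_apply]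
  rw [this]
  exact sum fun i _ => (linear (LinearMap.toContinuousLinearMap (b.coord i))).mul (coeff (hA _))

lemma multilinear_apply {N : ℕ} {C : V → MultilinearMap ℂ (fun _ : Fin N => V) ℂ}
    (hC : ∀ a, DifferentiableOn ℂ (fun z => C z a) U) {v : V × V → Fin N → V}
    (hv : ∀ i (l : V →ₗ[ℂ] ℂ), IsHolPoly U fun p => l (v p i)) :
    IsHolPoly U fun p => C p.1 (v p) := by
  simp only [fun p : V × V => (C p.1).eq_sum_basis (Module.finBasis ℂ V) (v p)]
  exact sum fun r _ => (prod fun i _ => hv i ((Module.finBasis ℂ V).coord (r i))).mul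
    (coeff (hC _))

end IsHolPoly

end HolPoly

namespace OrthLattice

variable {n : ℕ} {M : OrthLattice n} {Z₀ : CVec n}

namespace HypPair

variable (P : M.HypPair)

/-! ### The form, complex conjugation and imaginary parts on `L_ℂ` -/

lemma real_smul_eq (c : ℝ) (w : P.LC) : c • w = (c : ℂ) • w := by ext i; simp

lemma ip_comm (x y : P.LC) : P.ip x y = P.ip y x := M.form_comm _ _

@[simp] lemma ip_add_left (x y z : P.LC) : P.ip (x + y) z = P.ip x z + P.ip y z := by simp [ip]
@[simp] lemma ip_add_right (x y z : P.LC) : P.ip z (x + y) = P.ip z x + P.ip z y := by simp [ip]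
@[simp] lemma ip_sub_left (x y z : P.LC) : P.ip (x - y) z = P.ip x z - P.ip y z := by simp [ip]
@[simp] lemma ip_sub_right (x y z : P.LC) : P.ip z (x - y) = P.ip z x - P.ip z y := by simp [ip]
@[simp] lemma ip_neg_right (x z : P.LC) : P.ip z (-x) = -P.ip z x := by simp [ip]
@[simp] lemma ip_smul_left (c : ℂ) (x z : P.LC) : P.ip (c • x) z = c * P.ip x z := by simp [ip]
@[simp] lemma ip_smul_right (c : ℂ) (x z : P.LC) : P.ip z (c • x) = c * P.ip z x := by simp [ip]
@[simp] lemma ip_zero_left (z : P.LC) : P.ip 0 z = 0 := by simp [ip]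
@[simp] lemma ip_zero_right (z : P.LC) : P.ip z 0 = 0 := by simp [ip]

@[simp] lemma bar_bar (x : P.LC) : P.bar (P.bar x) = x := by ext i; simp [bar]
@[simp] lemma bar_add (x y : P.LC) : P.bar (x + y) = P.bar x + P.bar y := by ext i; simp [bar]
@[simp] lemma bar_sub (x y : P.LC) : P.bar (x - y) = P.bar x - P.bar y := by ext i; simp [bar]
@[simp] lemma bar_smul (c : ℂ) (x : P.LC) : P.bar (c • x) = conj c • P.bar x := by
  ext i; simp [bar]

lemma ip_bar_bar (x y : P.LC) : P.ip (P.bar x) (P.bar y) = conj (P.ip x y) :=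
  M.form_star _ _

@[simp] lemma bar_imag (x : P.LC) : P.bar (P.imag x) = P.imag x := by
  simp only [imag, bar_smul, bar_sub, bar_bar, map_inv₀, map_mul, Complex.conj_I, map_ofNat]
  rw [show (2 * -Complex.I)⁻¹ = -(2 * Complex.I)⁻¹ by rw [mul_neg, inv_neg]]
  module

lemma conj_ip_imag (x z : P.LC) : conj (P.ip x (P.imag z)) = P.ip (P.bar x) (P.imag z) := by
  rw [← P.ip_bar_bar, bar_imag]

lemma sub_bar (z : P.LC) : z - P.bar z = (2 * Complex.I) • P.imag z := by
  rw [imag, smul_smul, mul_inv_cancel₀ (by simp), one_smul]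

/-- The imaginary part as a continuous `ℝ`-linear map. -/
noncomputable def imagL : P.LC →L[ℝ] P.LC :=
  LinearMap.toContinuousLinearMap
    { toFun := P.imag
      map_add' := fun x y => by simp only [imag, bar_add, add_sub_add_comm, smul_add]
      map_smul' := fun c x => by
        simp only [imag, real_smul_eq, bar_smul, Complex.conj_ofReal, RingHom.id_apply]
        module }

@[simp] lemma imagL_apply (z : P.LC) : P.imagL z = P.imag z := rfl

/-- The form on `L_ℂ` as a continuous `ℝ`-bilinear map. -/
noncomputable def ipL : P.LC →L[ℝ] P.LC →L[ℝ] ℂ :=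
  LinearMap.toContinuousLinearMap
    { toFun := fun x => LinearMap.toContinuousLinearMap
        { toFun := fun y => P.ip x y
          map_add' := fun y z => P.ip_add_right y z x
          map_smul' := fun c y => by
            simp [real_smul_eq] }
      map_add' := fun x y => by ext z; simp
      map_smul' := fun c x => by
        ext z; simp [real_smul_eq] }

@[simp] lemma ipL_apply (x y : P.LC) : P.ipL x y = P.ip x y := rfl

/-! ### The conjugate-linear form `∂̄ T` and the derivative of `ν` -/

/-- The antiholomorphic direction in which the lowering operator differentiates. -/
noncomputable def lowerDir (a z : P.LC) : P.LC :=
  P.ip (P.imag z) (P.imag z) • P.bar a - (2 * P.ip (P.bar a) (P.imag z)) • P.imag z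

lemma lower_eq {s : ℕ} (T : P.LC → (Fin s → P.LC) → ℂ) (z : P.LC) (a : Fin (s + 1) → P.LC) :
    P.lower T z a = P.dbar (fun w => T w (Fin.init a)) z (P.lowerDir (a (Fin.last s)) z) := rfl

lemma exists_hasFDerivAt_lowerDir (a z : P.LC) : ∃ D : P.LC →L[ℝ] P.LC,
    HasFDerivAt (P.lowerDir a) D z ∧ ∀ u, D u =
      (2 * P.ip (P.imag z) (P.imag u)) • P.bar a -
        ((2 * P.ip (P.bar a) (P.imag z)) • P.imag u +
          (2 * P.ip (P.bar a) (P.imag u)) • P.imag z) := by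
  have hi : HasFDerivAt P.imag P.imagL z := P.imagL.hasFDerivAt
  have h₁ := (P.ipL.hasFDerivAt_of_bilinear hi hi).smul_const (P.bar a)
  have h₂ := (((P.ipL (P.bar a)).hasFDerivAt.comp z hi).const_mul 2).smul hi
  refine ⟨_, h₁.sub h₂, fun u => ?_⟩
  simp
  rw [P.ip_comm (P.imag u), ← two_mul]

lemma exists_hasFDerivAt_nu {z : P.LC} (hz : P.ip (P.imag z) (P.imag z) ≠ 0) :
    ∃ D : P.LC →L[ℝ] P.LC, HasFDerivAt P.nu D z ∧ ∀ u, D u =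
      (-Complex.I / P.ip (P.imag z) (P.imag z)) • P.imag u +
        (2 * Complex.I * P.ip (P.imag z) (P.imag u) / P.ip (P.imag z) (P.imag z) ^ 2) •
          P.imag z := by
  have hi : HasFDerivAt P.imag P.imagL z := P.imagL.hasFDerivAt
  have h₁ := P.ipL.hasFDerivAt_of_bilinear hi hi
  have h₂ := ((hasDerivAt_inv hz).comp_hasFDerivAt z h₁).const_mul (-Complex.I)
  refine ⟨_, h₂.smul hi, fun u => ?_⟩
  simp
  rw [P.ip_comm (P.imag u), ← two_mul]
  module

lemma lowerDir_bar (a z : P.LC) : P.bar (P.lowerDir a z) =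
    P.ip (P.imag z) (P.imag z) • a - (2 * P.ip a (P.imag z)) • P.imag z := by
  simp only [lowerDir, bar_sub, bar_smul, map_mul, conj_ip_imag, bar_imag, bar_bar, map_ofNat]

/-- `ν` is a primitive of the lowering operator: `L(ν) = ½ id`. -/
lemma dbar_comp_nu {Q : P.LC × P.LC → ℂ} {z : P.LC} (hz : P.ip (P.imag z) (P.imag z) ≠ 0)
    (hQ : DifferentiableAt ℂ Q (z, P.nu z)) (a : P.LC) :
    P.dbar (fun w => Q (w, P.nu w)) z (P.lowerDir a z) =
      (1 / 2 : ℂ) * fderiv ℂ Q (z, P.nu z) (0, a) := by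
  obtain ⟨D, hD, hDu⟩ := P.exists_hasFDerivAt_nu hz
  have h₁ := (hQ.hasFDerivAt.restrictScalars ℝ).comp z ((hasFDerivAt_id z).prodMk hD)
  have h₂ : fderiv ℝ (fun w => Q (w, P.nu w)) z = _ := h₁.fderiv
  simp only [dbar, h₂]
  set v := P.lowerDir a z with hv
  have hb := P.lowerDir_bar a z
  rw [← hv] at hb
  set y := P.imag z with hy
  have hDv : D v + Complex.I • D (Complex.I • v) = a := by
    have e₁ : P.imag v + Complex.I • P.imag (Complex.I • v) = Complex.I • P.bar v := by
      have hI : (2 * Complex.I)⁻¹ = -Complex.I / 2 := by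
        rw [mul_inv, Complex.inv_I]
        ring
      simp only [imag, bar_smul, Complex.conj_I, hI]
      match_scalars
      · linear_combination (-Complex.I / 2) * Complex.I_sq
      · linear_combination (-Complex.I / 2) * Complex.I_sq
    have e₂ : P.ip y (P.imag v) + Complex.I * P.ip y (P.imag (Complex.I • v)) =
        Complex.I * P.ip y (P.bar v) := by
      rw [← ip_smul_right, ← ip_add_right, e₁, ip_smul_right]
    have e₃ : P.ip y (P.bar v) = -(P.ip y y * P.ip a y) := by
      rw [hb, ip_sub_right, ip_smul_right, ip_smul_right, P.ip_comm y a]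
      ring
    rw [hDu, hDu]
    calc _ = (-Complex.I / P.ip y y) • (P.imag v + Complex.I • P.imag (Complex.I • v)) +
          (2 * Complex.I * (P.ip y (P.imag v) + Complex.I * P.ip y (P.imag (Complex.I • v))) /
            P.ip y y ^ 2) • y := by module
      _ = _ := by
        rw [e₁, e₂, e₃, hb]
        match_scalars
        · field_simp
          linear_combination -Complex.I_sq
        · field_simp
          linear_combination (2 - 2) * Complex.I_sq
  have e : fderiv ℂ Q (z, P.nu z) (0, a) = fderiv ℂ Q (z, P.nu z) (v, D v) +
      Complex.I * fderiv ℂ Q (z, P.nu z) (Complex.I • v, D (Complex.I • v)) := by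
    rw [← smul_eq_mul, ← map_smul, ← map_add, Prod.smul_mk, Prod.mk_add_mk, hDv, smul_smul,
      Complex.I_mul_I, neg_one_smul, add_neg_cancel]
  rw [e]
  rfl

lemma dbar_add (T : P.LC → ℂ) (z v w : P.LC) :
    P.dbar T z (v + w) = P.dbar T z v + P.dbar T z w := by
  simp only [dbar, smul_add, map_add]
  ring

/-- `∂̄ T` is conjugate-linear in the direction. -/
lemma dbar_smul (T : P.LC → ℂ) (z : P.LC) (c : ℂ) (v : P.LC) :
    P.dbar T z (c • v) = conj c * P.dbar T z v := by
  have h₁ : c • v = c.re • v + c.im • (Complex.I • v) := by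
    rw [real_smul_eq, real_smul_eq]
    conv_lhs => rw [← Complex.re_add_im c]
    module
  have h₂ : Complex.I • (c • v) = c.re • (Complex.I • v) + (-c.im) • v := by
    rw [real_smul_eq, real_smul_eq, smul_smul]
    conv_lhs => rw [← Complex.re_add_im c]
    match_scalars
    linear_combination c.im * Complex.I_sq
  have h₃ : conj c = c.re - c.im * Complex.I :=
    Complex.ext (by simp) (by simp)
  simp only [dbar]
  rw [h₂, h₁]
  simp only [map_add, (fderiv ℝ T z).map_smul, h₃, Complex.real_smul, Complex.ofReal_neg]
  linear_combination (1 / 2 * c.im * fderiv ℝ T z (Complex.I • v)) * Complex.I_sq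

/-- Lowering operators in different directions commute: second derivatives are symmetric, and so is
the derivative of the direction `lowerDir a` along `lowerDir b`. -/
lemma dbar_lowerDir_comm {U : Set P.LC} (hU : IsOpen U) {R : P.LC → ℂ}
    (hR : ContDiffOn ℝ ∞ R U) {z : P.LC} (hz : z ∈ U) (a b : P.LC) :
    P.dbar (fun w => P.dbar R w (P.lowerDir a w)) z (P.lowerDir b z) =
      P.dbar (fun w => P.dbar R w (P.lowerDir b w)) z (P.lowerDir a z) := by
  have hRz : ContDiffAt ℝ ∞ R z := hR.contDiffAt (hU.mem_nhds hz)
  have hsymm : IsSymmSndFDerivAt ℝ R z := hRz.isSymmSndFDerivAt (by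
    simpa using WithTop.coe_le_coe.2 (le_top : (2 : ℕ∞) ≤ ⊤))
  have hR' : HasFDerivAt (fderiv ℝ R) (fderiv ℝ (fderiv ℝ R) z) z :=
    ((hRz.fderiv_right (m := ∞) (by simp)).differentiableAt (by simp)).hasFDerivAt
  set D₂ := fderiv ℝ (fderiv ℝ R) z with hD₂
  set y := P.imag z with hy
  -- The derivative of `L_c R` in the direction `u`.
  have hder : ∀ c : P.LC, ∀ u, fderiv ℝ (fun w => P.dbar R w (P.lowerDir c w)) z u =
      (1 / 2 : ℂ) * (D₂ u (P.lowerDir c z) + Complex.I * D₂ u (Complex.I • P.lowerDir c z)) +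
        P.dbar R z ((2 * P.ip y (P.imag u)) • P.bar c -
          ((2 * P.ip (P.bar c) y) • P.imag u + (2 * P.ip (P.bar c) (P.imag u)) • y)) := by
    intro c u
    obtain ⟨D, hD, hDu⟩ := P.exists_hasFDerivAt_lowerDir c z
    have h₁ := ((hR'.clm_apply hD).add
      ((hR'.clm_apply (hD.const_smul Complex.I)).const_mul Complex.I)).const_mul (1 / 2 : ℂ)
    have h₂ : fderiv ℝ (fun w => P.dbar R w (P.lowerDir c w)) z = _ := h₁.fderiv
    rw [h₂, ← hDu]
    simp only [dbar, add_apply, smul_apply, ContinuousLinearMap.comp_apply,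
      ContinuousLinearMap.flip_apply, smul_eq_mul, Pi.smul_apply]
    ring
  have him : ∀ v : P.LC, P.imag v - Complex.I • P.imag (Complex.I • v) = -Complex.I • v := by
    intro v
    have hI : (2 * Complex.I)⁻¹ = -Complex.I / 2 := by
      rw [mul_inv, Complex.inv_I]
      ring
    simp only [imag, bar_smul, Complex.conj_I, hI]
    match_scalars
    · linear_combination (Complex.I / 2) * Complex.I_sq
    · linear_combination (Complex.I / 2) * Complex.I_sq
  -- The first-order part of `L_b L_c R` is the derivative of `R` in a direction symmetric in
  -- `b` and `c`.
  have hK : ∀ c d : P.LC, P.dbar (fun w => P.dbar R w (P.lowerDir c w)) z (P.lowerDir d z) =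
      (1 / 4 : ℂ) * (D₂ (P.lowerDir d z) (P.lowerDir c z) +
        Complex.I * D₂ (P.lowerDir d z) (Complex.I • P.lowerDir c z) +
        Complex.I * D₂ (Complex.I • P.lowerDir d z) (P.lowerDir c z) -
        D₂ (Complex.I • P.lowerDir d z) (Complex.I • P.lowerDir c z)) +
      (1 / 2 : ℂ) * P.dbar R z ((-2 * Complex.I) • (
        (4 * P.ip (P.bar c) y * P.ip (P.bar d) y - P.ip y y * P.ip (P.bar c) (P.bar d)) • y -
        (P.ip y y * P.ip (P.bar d) y) • P.bar c - (P.ip y y * P.ip (P.bar c) y) • P.bar d)) := by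
    intro c d
    set v := P.lowerDir d z with hv
    have hW : ((2 * P.ip y (P.imag v)) • P.bar c -
          ((2 * P.ip (P.bar c) y) • P.imag v + (2 * P.ip (P.bar c) (P.imag v)) • y)) +
        (-Complex.I) • ((2 * P.ip y (P.imag (Complex.I • v))) • P.bar c -
          ((2 * P.ip (P.bar c) y) • P.imag (Complex.I • v) +
            (2 * P.ip (P.bar c) (P.imag (Complex.I • v))) • y)) =
        (-2 * Complex.I) • (
        (4 * P.ip (P.bar c) y * P.ip (P.bar d) y - P.ip y y * P.ip (P.bar c) (P.bar d)) • y -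
        (P.ip y y * P.ip (P.bar d) y) • P.bar c - (P.ip y y * P.ip (P.bar c) y) • P.bar d) := by
      have e : ∀ x : P.LC, P.ip x (P.imag v) - Complex.I * P.ip x (P.imag (Complex.I • v)) =
          -Complex.I * P.ip x v := by
        intro x
        rw [← ip_smul_right, ← ip_sub_right, him, ip_smul_right]
      calc _ = (2 * (P.ip y (P.imag v) - Complex.I * P.ip y (P.imag (Complex.I • v)))) • P.bar c -
            ((2 * P.ip (P.bar c) y) • (P.imag v - Complex.I • P.imag (Complex.I • v)) +
            (2 * (P.ip (P.bar c) (P.imag v) - Complex.I * P.ip (P.bar c)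
              (P.imag (Complex.I • v)))) • y) := by module
        _ = _ := by
          rw [e, e, him, hv, lowerDir]
          simp only [ip_sub_right, ip_smul_right, ← hy, P.ip_comm y (P.bar d)]
          module
    rw [dbar, hder, hder]
    rw [← hW, dbar_add, dbar_smul, map_neg, Complex.conj_I, neg_neg]
    linear_combination (1 / 4 : ℂ) * D₂ (Complex.I • v) (Complex.I • P.lowerDir c z) * Complex.I_sq
  rw [hK, hK, hsymm.eq (P.lowerDir b z) (P.lowerDir a z),
    hsymm.eq (Complex.I • P.lowerDir b z) (Complex.I • P.lowerDir a z),
    hsymm.eq (P.lowerDir b z) (Complex.I • P.lowerDir a z),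
    hsymm.eq (Complex.I • P.lowerDir b z) (P.lowerDir a z), P.ip_comm (P.bar b) (P.bar a)]
  congr 1
  · ring
  · congr 3
    module

/-! ### Positivity on the tube domain -/

lemma form_phi_phi (z w : P.LC) :
    M.form (P.phi z) (P.phi w) = -(1 / 2) * P.ip (z - w) (z - w) := by
  have h₁ := P.form_e_LC z
  have h₂ := P.form_f_LC z
  have h₃ := P.form_e_LC w
  have h₄ := P.form_f_LC w
  rw [M.form_comm] at h₁ h₂
  have h₅ := P.ef
  rw [M.form_comm] at h₅
  have h₆ : M.form (z : CVec n) (w : CVec n) = P.ip z w := rfl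
  simp [phi, h₁, h₂, h₃, h₄, h₅, h₆, P.ee, P.ff, P.ef, P.ip_comm w z]
  ring

lemma star_phi (z : P.LC) : star (P.phi z) = P.phi (P.bar z) := by
  have h : conj (P.ip z z) = P.ip (P.bar z) (P.bar z) := (P.ip_bar_bar z z).symm
  ext i
  simp only [phi, ← h]
  simp [realVec, bar]

lemma ip_imag_imag_ne_zero {z : P.LC} (hz : z ∈ P.tube Z₀) :
    P.ip (P.imag z) (P.imag z) ≠ 0 := by
  intro h
  have hc : P.phi z ∈ M.cone := connectedComponentIn_subset _ _ hz
  have h2 := hc.2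
  rw [star_phi, form_phi_phi, sub_bar, ip_smul_left, ip_smul_right, h] at h2
  simp at h2

/-! ### Holomorphic functions of `z` and `ν` -/

/-- The values `ν(z)` are independent of `z` as far as holomorphic functions are concerned: applying
the lowering operator to `Q(z, ν(z)) = 0` shows that all derivatives of `Q(z, ·)` vanish at
`ν(z)`. -/
lemma eq_zero_of_comp_nu_eq_zero {Q : P.LC × P.LC → ℂ} (hQ : IsHolPoly (P.tube Z₀) Q)
    (h : ∀ z ∈ P.tube Z₀, Q (z, P.nu z) = 0) :
    ∀ z ∈ P.tube Z₀, ∀ x, Q (z, x) = 0 := by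
  intro z hz x
  have hU := P.isOpen_tube Z₀
  set a := x - P.nu z with ha
  choose! D' hD' hD'' using fun (R : P.LC × P.LC → ℂ) (hR : IsHolPoly (P.tube Z₀) R) =>
    hR.exists_fderiv hU a
  -- The iterated derivatives of `Q` in the direction `(0, a)`.
  let D : ℕ → P.LC × P.LC → ℂ := fun m => Nat.rec Q (fun _ R => D' R) m
  have hD : ∀ m, IsHolPoly (P.tube Z₀) (D m) ∧ ∀ w ∈ P.tube Z₀, D m (w, P.nu w) = 0 := by
    intro m
    induction m with
    | zero => exact ⟨hQ, h⟩
    | succ m ih =>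
      refine ⟨hD' _ ih.1, fun w hw => ?_⟩
      have h₁ := P.dbar_comp_nu (P.ip_imag_imag_ne_zero hw) (ih.1.differentiableAt hU hw _) a
      rw [P.dbar_congr (T' := fun _ => 0) hw ih.2, hD'' _ ih.1 w hw] at h₁
      have h₂ : P.dbar (fun _ => (0 : ℂ)) w (P.lowerDir a w) = 0 := by simp [dbar]
      rw [h₂] at h₁
      simpa using h₁.symm
  have hline : ∀ m, ∀ t : ℂ, HasDerivAt (fun t : ℂ => D m (z, P.nu z + t • a))
      (D (m + 1) (z, P.nu z + t • a)) t := by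
    intro m t
    have h₁ := ((hD m).1.differentiableAt hU hz (P.nu z + t • a)).hasFDerivAt
    have h₂ : HasDerivAt (fun t : ℂ => (z, P.nu z + t • a)) ((0 : P.LC), a) t := by
      refine (hasDerivAt_const t z).prodMk ?_
      simpa using ((hasDerivAt_id t).smul_const a).const_add (P.nu z)
    have h₃ := h₁.comp_hasDerivAt t h₂
    rw [hD'' _ (hD m).1 z hz] at h₃
    exact h₃
  have hiter : ∀ m, iteratedDeriv m (fun t : ℂ => D 0 (z, P.nu z + t • a)) =
      fun t => D m (z, P.nu z + t • a) := by
    intro m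
    induction m with
    | zero => exact iteratedDeriv_zero
    | succ m ih =>
      rw [iteratedDeriv_succ, ih]
      exact funext fun t => (hline m t).deriv
  have htaylor := Complex.taylorSeries_eq_of_entire'
    (f := fun t : ℂ => D 0 (z, P.nu z + t • a)) 0 1 (fun t => (hline 0 t).differentiableAt)
  have hzero : ∀ m, iteratedDeriv m (fun t : ℂ => D 0 (z, P.nu z + t • a)) 0 = 0 := by
    intro m
    rw [hiter]
    simpa using (hD m).2 z hz
  simp only [hzero, mul_zero, zero_mul, tsum_zero, one_smul] at htaylor
  rw [ha, add_sub_cancel] at htaylor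
  exact htaylor.symm

lemma isHolPoly_expansion {s : ℕ} (d : ℕ)
    {c : (t : ℕ) → P.LC → MultilinearMap ℂ (fun _ : Fin (s + t) => P.LC) ℂ}
    (hc : ∀ t a, DifferentiableOn ℂ (fun z => c t z a) (P.tube Z₀))
    {v : P.LC → Fin s → P.LC} {x : P.LC × P.LC → P.LC}
    (hv : ∀ i, DifferentiableOn ℂ (fun z => v z i) (P.tube Z₀))
    (hx : ∀ l : P.LC →ₗ[ℂ] ℂ, IsHolPoly (P.tube Z₀) fun p => l (x p)) :
    IsHolPoly (P.tube Z₀) (fun p => ∑ t ∈ Finset.range (d + 1),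
      c t p.1 (Fin.append (v p.1) (fun _ : Fin t => x p))) := by
  refine IsHolPoly.sum fun t _ => IsHolPoly.multilinear_apply (hc t) fun i l => ?_
  refine Fin.addCases (fun i => ?_) (fun i => ?_) i
  · simp only [Fin.append_left]
    exact .coeff (h := fun z => l (v z i))
      ((LinearMap.toContinuousLinearMap l).differentiable.comp_differentiableOn (hv i))
  · simpa only [Fin.append_right] using hx l

lemma sum_append_zero {s : ℕ} (d : ℕ)
    (c : (t : ℕ) → MultilinearMap ℂ (fun _ : Fin (s + t) => P.LC) ℂ) (a : Fin s → P.LC) :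
    ∑ t ∈ Finset.range (d + 1), c t (Fin.append a (fun _ : Fin t => 0)) = c 0 a := by
  rw [Finset.sum_range_succ', Finset.sum_eq_zero, zero_add]
  · congr 1
    funext i
    exact Fin.append_left a _ i
  · intro t _
    refine (c (t + 1)).map_coord_zero (Fin.natAdd s (Fin.last t)) ?_
    exact Fin.append_right _ _ _

lemma HasConstantTerm.unique {s : ℕ} {T : P.LC → (Fin s → P.LC) → ℂ}
    {f g : P.tube Z₀ → MultilinearMap ℂ (fun _ : Fin s => P.LC) ℂ}
    (hf : P.HasConstantTerm Z₀ T f) (hg : P.HasConstantTerm Z₀ T g) : f = g := by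
  obtain ⟨d, c, hol, hexp, hct⟩ := HasConstantTerm.comb (T := fun _ _ => 0) (-1) hf hg
    (fun z _ a => by ring)
  suffices h : ∀ z : P.tube Z₀, c 0 z = 0 by
    funext z
    have := (hct z).trans (h z)
    simp only [Pi.add_apply, neg_smul, one_smul] at this
    exact (neg_add_eq_zero.1 this)
  intro z
  ext a
  have h := P.eq_zero_of_comp_nu_eq_zero (Z₀ := Z₀)
    (P.isHolPoly_expansion d hol (v := fun _ => a) (x := Prod.snd)
      (fun i => differentiableOn_const _) fun l => .linear (LinearMap.toContinuousLinearMap l))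
    (fun w hw => (hexp w hw a).symm) z z.2 0
  rw [sum_append_zero P d (fun t => c t z)] at h
  exact h

/-! ### Multilinearity and symmetry of iterated lowering operators -/

lemma lowerDir_add (a b z : P.LC) : P.lowerDir (a + b) z = P.lowerDir a z + P.lowerDir b z := by
  simp only [lowerDir, bar_add, ip_add_left]
  module

lemma lowerDir_smul (c : ℂ) (a z : P.LC) : P.lowerDir (c • a) z = conj c • P.lowerDir a z := by
  simp only [lowerDir, bar_smul, ip_smul_left]
  module

lemma exists_lowerDir_eq {z : P.LC} (hz : P.ip (P.imag z) (P.imag z) ≠ 0) (v : P.LC) :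
    ∃ a, P.lowerDir a z = v := by
  -- `lowerDir a z` is `⟨y, y⟩` times a reflection applied to the conjugate of `a`.
  refine ⟨P.bar ((P.ip (P.imag z) (P.imag z) ^ 2)⁻¹ •
    (P.ip (P.imag z) (P.imag z) • v - (2 * P.ip v (P.imag z)) • P.imag z)), ?_⟩
  simp only [lowerDir, bar_bar, ip_smul_left, ip_sub_left]
  match_scalars
  · field_simp
  · field_simp
    ring

lemma lower_multilinear {s : ℕ} {T : P.LC → (Fin s → P.LC) → ℂ}
    (hT : ∀ a, ContDiffOn ℝ ∞ (fun z => T z a) (P.tube Z₀))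
    (hm : ∀ z ∈ P.tube Z₀, ∃ m : MultilinearMap ℂ (fun _ : Fin s => P.LC) ℂ, ∀ a, T z a = m a) :
    ∀ z ∈ P.tube Z₀, ∃ m : MultilinearMap ℂ (fun _ : Fin (s + 1) => P.LC) ℂ,
      ∀ a, P.lower T z a = m a := by
  intro z hz
  choose! m hm using hm
  have hcomb : ∀ (c : ℂ) (a₁ a₂ a : Fin s → P.LC) (v : P.LC),
      (∀ w ∈ P.tube Z₀, m w a = c * m w a₁ + m w a₂) →
      P.dbar (fun w => T w a) z v =
        c * P.dbar (fun w => T w a₁) z v + P.dbar (fun w => T w a₂) z v := by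
    intro c a₁ a₂ a v h
    rw [← P.dbar_comb hz (hT a₁) (hT a₂)]
    exact P.dbar_congr hz (fun w hw => by rw [hm w hw, hm w hw, hm w hw, h w hw]) v
  let f : MultilinearMap ℂ (fun _ : Fin s => P.LC) (P.LC →ₗ[ℂ] ℂ) :=
    { toFun := fun a =>
        { toFun := fun b => P.dbar (fun w => T w a) z (P.lowerDir b z)
          map_add' := fun b c => by rw [lowerDir_add, dbar_add]
          map_smul' := fun c b => by
            rw [lowerDir_smul, dbar_smul, Complex.conj_conj, RingHom.id_apply, smul_eq_mul] }
      map_update_add' := fun a i x y => by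
        ext b
        have := hcomb 1 (Function.update a i x) (Function.update a i y)
          (Function.update a i (x + y)) (P.lowerDir b z) (fun w _ => by
            rw [MultilinearMap.map_update_add, one_mul])
        rw [one_mul] at this
        exact this
      map_update_smul' := fun a i c x => by
        ext b
        have := hcomb c (Function.update a i x) (Function.update a i 0)
          (Function.update a i (c • x)) (P.lowerDir b z) (fun w _ => by
            rw [MultilinearMap.map_update_smul, MultilinearMap.map_update_zero, add_zero,
              smul_eq_mul])
        have h0 : P.dbar (fun w => T w (Function.update a i 0)) z (P.lowerDir b z) = 0 := by
          rw [P.dbar_congr (T' := fun _ => 0) hz fun w hw => by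
            rw [hm w hw, MultilinearMap.map_update_zero]]
          simp [dbar]
        rw [h0, add_zero] at this
        exact this }
  exact ⟨f.uncurryRight, fun a => by rw [lower_eq]; rfl⟩

lemma lowerIter_multilinear {s : ℕ} {T : P.LC → (Fin s → P.LC) → ℂ}
    (hT : ∀ a, ContDiffOn ℝ ∞ (fun z => T z a) (P.tube Z₀))
    (hm : ∀ z ∈ P.tube Z₀, ∃ m : MultilinearMap ℂ (fun _ : Fin s => P.LC) ℂ, ∀ a, T z a = m a)
    (d : ℕ) :
    ∀ z ∈ P.tube Z₀, ∃ m : MultilinearMap ℂ (fun _ : Fin (s + d) => P.LC) ℂ,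
      ∀ a, P.lowerIter T d z a = m a := by
  induction d with
  | zero => exact hm
  | succ d ih => exact P.lower_multilinear (P.lowerIter_smooth Z₀ hT d) ih

lemma lowerIter_succ {s : ℕ} (T : P.LC → (Fin s → P.LC) → ℂ) (d : ℕ) (z : P.LC)
    (a : Fin (s + (d + 1)) → P.LC) : P.lowerIter T (d + 1) z a =
      P.dbar (fun w => P.lowerIter T d w (Fin.init a : Fin (s + d) → P.LC)) z
        (P.lowerDir (a (Fin.last (s + d))) z) := rfl

/-- As lowering operators in different directions commute, `L^d T` is symmetric in its last `d`
arguments. -/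
lemma lowerIter_symm {s : ℕ} {T : P.LC → (Fin s → P.LC) → ℂ}
    (hT : ∀ a, ContDiffOn ℝ ∞ (fun z => T z a) (P.tube Z₀)) (d : ℕ) :
    ∀ z ∈ P.tube Z₀, ∀ i j : Fin (s + d), s ≤ i → s ≤ j → ∀ a,
      P.lowerIter T d z (a ∘ Equiv.swap i j) = P.lowerIter T d z a := by
  induction d with
  | zero => intro z _ i j hi; exact absurd i.2 (by omega)
  | succ d ih =>
    intro z hz
    -- The case in which the last argument is not involved.
    have hcast : ∀ i j : Fin (s + d), s ≤ (i : ℕ) → s ≤ (j : ℕ) → ∀ a : Fin (s + (d + 1)) → P.LC,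
        P.lowerIter T (d + 1) z (a ∘ Equiv.swap (Fin.castSucc i) (Fin.castSucc j)) =
          P.lowerIter T (d + 1) z a := by
      intro i j hi hj a
      have h₁ : Fin.init (a ∘ Equiv.swap (Fin.castSucc i) (Fin.castSucc j) :
          Fin (s + d + 1) → P.LC) = (Fin.init a : Fin (s + d) → P.LC) ∘ Equiv.swap i j := by
        funext k
        simp only [Fin.init, Function.comp_apply]
        rw [(Fin.castSucc_injective _).swap_apply]
      have h₂ : (a ∘ Equiv.swap (Fin.castSucc i) (Fin.castSucc j)) (Fin.last (s + d)) =
          a (Fin.last (s + d)) := by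
        rw [Function.comp_apply, Equiv.swap_apply_of_ne_of_ne (Fin.castSucc_lt_last i).ne'
          (Fin.castSucc_lt_last j).ne']
      rw [lowerIter_succ, lowerIter_succ, h₂]
      exact P.dbar_congr hz (fun w hw => by rw [h₁, ih w hw i j hi hj]) _
    -- The last two arguments are exchanged by commutativity.
    have hlast : ∀ i : Fin (s + d), (i : ℕ) + 1 = s + d → s ≤ (i : ℕ) →
        ∀ a : Fin (s + (d + 1)) → P.LC,
        P.lowerIter T (d + 1) z (a ∘ Equiv.swap (Fin.castSucc i) (Fin.last (s + d))) =
          P.lowerIter T (d + 1) z a := by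
      intro i hi hsi a
      obtain _ | d := d
      · omega
      obtain rfl : i = Fin.last (s + d) := Fin.ext (by simp; omega)
      rw [lowerIter_succ, lowerIter_succ]
      simp only [lowerIter_succ]
      set b : Fin (s + (d + 1 + 1)) → P.LC :=
        a ∘ Equiv.swap (Fin.castSucc (Fin.last (s + d))) (Fin.last (s + (d + 1))) with hb
      have e₁ : b (Fin.last (s + (d + 1))) = a (Fin.castSucc (Fin.last (s + d))) := by
        simp [hb]
      have e₂ : (Fin.init b : Fin (s + d + 1) → P.LC) (Fin.last (s + d)) =
          a (Fin.last (s + (d + 1))) := by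
        simp [hb, Fin.init]
      have e₃ : (Fin.init (Fin.init b : Fin (s + d + 1) → P.LC) : Fin (s + d) → P.LC) =
          Fin.init (Fin.init a : Fin (s + d + 1) → P.LC) := by
        funext k
        simp only [hb, Fin.init, Function.comp_apply]
        rw [Equiv.swap_apply_of_ne_of_ne]
        · exact fun h => (Fin.castSucc_lt_last k).ne (Fin.castSucc_injective _ h)
        · exact (Fin.castSucc_lt_last _).ne
      rw [e₁, e₂, e₃]
      exact P.dbar_lowerDir_comm (P.isOpen_tube Z₀)
        (P.lowerIter_smooth Z₀ hT d _) hz _ _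
    have hlast' : ∀ i : Fin (s + d), s ≤ (i : ℕ) → ∀ a : Fin (s + (d + 1)) → P.LC,
        P.lowerIter T (d + 1) z (a ∘ Equiv.swap (Fin.castSucc i) (Fin.last (s + d))) =
          P.lowerIter T (d + 1) z a := by
      intro i hi a
      by_cases h : (i : ℕ) + 1 = s + d
      · exact hlast i h hi a
      · -- conjugate the transposition of the last two arguments
        have hi2 := i.2
        let k : Fin (s + d) := ⟨s + d - 1, by omega⟩
        have hk : (k : ℕ) + 1 = s + d := by simp only [k]; omega
        have hsk : s ≤ (k : ℕ) := by omega
        have hik : i ≠ k := fun e => h (by rw [e, hk])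
        have hconj : Equiv.swap (Fin.castSucc i) (Fin.last (s + d)) =
            Equiv.swap (Fin.castSucc i) (Fin.castSucc k) *
              Equiv.swap (Fin.castSucc k) (Fin.last (s + d)) *
              Equiv.swap (Fin.castSucc i) (Fin.castSucc k) := by
          rw [Equiv.swap_comm (Fin.castSucc i) (Fin.castSucc k),
            Equiv.swap_comm (Fin.castSucc k) (Fin.last (s + d)),
            Equiv.swap_mul_swap_mul_swap (Fin.castSucc_lt_last k).ne'
              (Fin.castSucc_lt_last i).ne']
        rw [hconj, Equiv.Perm.coe_mul, Equiv.Perm.coe_mul, ← Function.comp_assoc,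
          ← Function.comp_assoc, hcast i k hi hsk, hlast k hk hsk, hcast i k hi hsk]
    intro i j hi hj a
    rcases Fin.eq_castSucc_or_eq_last i with ⟨i, rfl⟩ | rfl <;>
      rcases Fin.eq_castSucc_or_eq_last j with ⟨j, rfl⟩ | rfl
    · exact hcast i j hi hj a
    · exact hlast' i hi a
    · rw [Equiv.swap_comm]
      exact hlast' j hj a
    · simp

/-! ### Existence of the constant term -/

lemma differentiableAt_of_dbar_eq_zero {T : P.LC → ℂ} {z : P.LC} (hT : DifferentiableAt ℝ T z)
    (h : ∀ v, P.dbar T z v = 0) : DifferentiableAt ℂ T z := by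
  have hI : ∀ v, fderiv ℝ T z (Complex.I • v) = Complex.I * fderiv ℝ T z v := by
    intro v
    have := h v
    simp only [dbar] at this
    linear_combination (-2 * Complex.I) * this + fderiv ℝ T z (Complex.I • v) * Complex.I_sq
  rw [differentiableAt_iff_restrictScalars ℝ hT]
  refine ⟨LinearMap.toContinuousLinearMap
    { toFun := fderiv ℝ T z
      map_add' := map_add _
      map_smul' := fun c v => ?_ }, rfl⟩
  have h₁ : c • v = c.re • v + c.im • (Complex.I • v) := by
    rw [real_smul_eq, real_smul_eq]
    conv_lhs => rw [← Complex.re_add_im c]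
    module
  rw [h₁, map_add, (fderiv ℝ T z).map_smul, (fderiv ℝ T z).map_smul, hI]
  conv_rhs => rw [RingHom.id_apply, ← Complex.re_add_im c]
  simp only [Complex.real_smul, smul_eq_mul]
  ring

/-- The lowering operator acts on polynomials in `ν` with holomorphic coefficients as
`½ ∂/∂ν`. -/
lemma lowerIter_fillWith_nu {s d : ℕ}
    {S : P.LC → MultilinearMap ℂ (fun _ : Fin (s + d) => P.LC) ℂ}
    (hol : ∀ a, DifferentiableOn ℂ (fun z => S z a) (P.tube Z₀))
    (hsymm : ∀ z ∈ P.tube Z₀, ∀ i j : Fin (s + d), s ≤ i → s ≤ j → ∀ a,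
      S z (a ∘ Equiv.swap i j) = S z a) (j : ℕ) (hj : j ≤ d) :
    ∀ z ∈ P.tube Z₀, ∀ a : Fin (s + j) → P.LC,
      P.lowerIter (fun z (a : Fin s → P.LC) => S z (fillWith a (P.nu z))) j z a =
        ((d.descFactorial j : ℂ) / 2 ^ j) * S z (fillWith a (P.nu z)) := by
  induction j with
  | zero => intro z _ a; simp [lowerIter]
  | succ j ih =>
    intro z hz a
    have hU := P.isOpen_tube Z₀
    rw [lowerIter_succ]
    let Q : P.LC × P.LC → ℂ := fun p =>
      ((d.descFactorial j : ℂ) / 2 ^ j) * S p.1 (fillWith (Fin.init (n := s + j) a) p.2)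
    have hQ : IsHolPoly (P.tube Z₀) Q := by
      refine (IsHolPoly.const _).mul (IsHolPoly.multilinear_apply hol fun i l => ?_)
      by_cases h : (i : ℕ) < s + j
      · simp only [fillWith, h, dif_pos]
        exact .const (l _)
      · simp only [fillWith, h, dif_neg, not_false_eq_true]
        exact .linear (LinearMap.toContinuousLinearMap l)
    rw [P.dbar_congr (T' := fun w => Q (w, P.nu w)) hz fun w hw => ih (by omega) w hw _,
      P.dbar_comp_nu (P.ip_imag_imag_ne_zero hz) (hQ.differentiableAt hU hz _)]
    obtain ⟨hdiff, hder⟩ := fderiv_map_fillWith (S z) (Fin.init (n := s + j) a) (P.nu z)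
    have h₁ : fderiv ℂ Q (z, P.nu z) (0, a (Fin.last (s + j))) =
        ((d.descFactorial j : ℂ) / 2 ^ j) *
          fderiv ℂ (fun x => S z (fillWith (Fin.init (n := s + j) a) x)) (P.nu z)
            (a (Fin.last (s + j))) := by
      have h₂ := (hQ.differentiableAt hU hz (P.nu z)).hasFDerivAt.comp (P.nu z)
        (hasFDerivAt_prodMk_right z (P.nu z))
      have h₃ := hdiff.hasFDerivAt.const_mul ((d.descFactorial j : ℂ) / 2 ^ j)
      have h₄ := congrArg (fun l : P.LC →L[ℂ] ℂ => l (a (Fin.last (s + j)))) (h₂.unique h₃)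
      simpa using h₄
    have h₅ : ∀ i : Fin (s + d), (if (i : ℕ) < s + j then 0 else
        S z (Function.update (fillWith (Fin.init (n := s + j) a) (P.nu z)) i
          (a (Fin.last (s + j))))) =
        if (i : ℕ) < s + j then 0 else S z (fillWith a (P.nu z)) := by
      intro i
      split_ifs with h
      · rfl
      · rw [update_fillWith (m := s + j) a (P.nu z) i (not_lt.1 h)]
        exact hsymm z hz _ _ (by omega) (by simp) _
    have hcard : ((Finset.range (s + d)).filter fun i => ¬ i < s + j).card = d - j := by
      have : (Finset.range (s + d)).filter (fun i => ¬ i < s + j) = Finset.Ico (s + j) (s + d) := by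
        ext i
        simp only [Finset.mem_filter, Finset.mem_range, Finset.mem_Ico]
        omega
      rw [this, Nat.card_Ico]
      omega
    rw [h₁, hder, Finset.sum_congr rfl fun i _ => h₅ i,
      Fin.sum_univ_eq_sum_range (fun i => if i < s + j then 0 else S z (fillWith a (P.nu z))),
      Finset.sum_ite, Finset.sum_const_zero, zero_add, Finset.sum_const, hcard,
      Nat.descFactorial_succ, nsmul_eq_mul]
    push_cast
    change _ = _ * (S z) (fillWith a (P.nu z))
    field_simp
    ring

lemma contDiffOn_nu : ContDiffOn ℝ ∞ P.nu (P.tube Z₀) := by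
  have h : ContDiffOn ℝ ∞ (fun z => P.ip (P.imag z) (P.imag z)) (P.tube Z₀) :=
    (P.contDiff_ip P.contDiff_imag P.contDiff_imag).contDiffOn
  have h' : ContDiffOn ℝ ∞ (fun z => -Complex.I / P.ip (P.imag z) (P.imag z)) (P.tube Z₀) := by
    simp only [div_eq_mul_inv]
    exact contDiffOn_const.mul (h.inv fun z hz => P.ip_imag_imag_ne_zero hz)
  exact h'.smul P.contDiff_imag.contDiffOn

lemma hasConstantTerm_fillWith_nu {s d : ℕ}
    {S : P.LC → MultilinearMap ℂ (fun _ : Fin (s + d) => P.LC) ℂ}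
    (hol : ∀ a, DifferentiableOn ℂ (fun z => S z a) (P.tube Z₀)) :
    ∃ f, P.HasConstantTerm Z₀ (fun z (a : Fin s → P.LC) => S z (fillWith a (P.nu z))) f := by
  classical
  let c : (t : ℕ) → P.LC → MultilinearMap ℂ (fun _ : Fin (s + t) => P.LC) ℂ :=
    fun t z => if h : t = d then h ▸ S z else 0
  have hc : ∀ z, c d z = S z := fun z => by simp [c]
  have hc' : ∀ t ≠ d, ∀ z, c t z = 0 := fun t ht z => by simp [c, ht]
  refine ⟨fun z => c 0 z, d, c, fun t a => ?_, fun z hz a => ?_, fun z => rfl⟩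
  · by_cases ht : t = d
    · subst ht
      simpa only [hc] using hol a
    · simp only [hc' t ht]
      exact differentiableOn_const 0
  · rw [Finset.sum_eq_single d (fun t _ ht => by rw [hc' t ht]; rfl) (by simp), hc,
      ← fillWith_eq_append]

/-- A smooth tensor annihilated by a power of the lowering operator is a polynomial in `ν` with
holomorphic coefficients: its leading coefficient is, up to a factor, the last non-vanishing
`L^d T`, which is holomorphic and symmetric. -/
lemma exists_hasConstantTerm {s : ℕ} (d : ℕ) : ∀ T : P.LC → (Fin s → P.LC) → ℂ,
    (∀ a, ContDiffOn ℝ ∞ (fun z => T z a) (P.tube Z₀)) →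
    (∀ z ∈ P.tube Z₀, ∃ m : MultilinearMap ℂ (fun _ : Fin s => P.LC) ℂ, ∀ a, T z a = m a) →
    (∀ z ∈ P.tube Z₀, ∀ a, P.lowerIter T d z a = 0) →
    ∃ f, P.HasConstantTerm Z₀ T f := by
  have hU := P.isOpen_tube Z₀
  induction d with
  | zero =>
    intro T _ _ h
    have := HasConstantTerm.comb (T := T) 0 (HasConstantTerm.zero P Z₀ s)
      (HasConstantTerm.zero P Z₀ s) (fun z hz a => by simpa [lowerIter] using h z hz a)
    exact ⟨_, this⟩
  | succ d ih =>
    intro T hT hm h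
    choose! S hS using P.lowerIter_multilinear hT hm d
    have hsmooth : ∀ a, ContDiffOn ℝ ∞ (fun z => S z a) (P.tube Z₀) := fun a =>
      (P.lowerIter_smooth Z₀ hT d a).congr fun z hz => (hS z hz a).symm
    have hol : ∀ a, DifferentiableOn ℂ (fun z => S z a) (P.tube Z₀) := by
      intro a z hz
      refine (P.differentiableAt_of_dbar_eq_zero
        (((hsmooth a).contDiffAt (hU.mem_nhds hz)).differentiableAt (by simp))
        fun v => ?_).differentiableWithinAt
      obtain ⟨b, rfl⟩ := P.exists_lowerDir_eq (P.ip_imag_imag_ne_zero hz) v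
      have := h z hz (Fin.snoc a b : Fin (s + d + 1) → P.LC)
      rw [lowerIter_succ, Fin.init_snoc, Fin.snoc_last] at this
      rw [← this]
      exact P.dbar_congr hz (fun w hw => (hS w hw a).symm) _
    have hsymm : ∀ z ∈ P.tube Z₀, ∀ i j : Fin (s + d), s ≤ i → s ≤ j → ∀ a,
        S z (a ∘ Equiv.swap i j) = S z a := by
      intro z hz i j hi hj a
      rw [← hS z hz, ← hS z hz, P.lowerIter_symm hT d z hz i j hi hj]
    set R : P.LC → (Fin s → P.LC) → ℂ := fun z a => S z (fillWith a (P.nu z)) with hR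
    have hRsmooth : ∀ a, ContDiffOn ℝ ∞ (fun z => R z a) (P.tube Z₀) := by
      intro a
      refine ContDiffOn.multilinear_apply hsmooth fun i => ?_
      by_cases hi : (i : ℕ) < s
      · simp only [fillWith, hi, dif_pos]
        exact contDiffOn_const
      · simp only [fillWith, hi, dif_neg, not_false_eq_true]
        exact P.contDiffOn_nu
    have hRm : ∀ z ∈ P.tube Z₀, ∃ m : MultilinearMap ℂ (fun _ : Fin s => P.LC) ℂ,
        ∀ a, R z a = m a := by
      intro z _
      exact ⟨
        { toFun := fun a => S z (fillWith a (P.nu z))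
          map_update_add' := fun a i x y => by simp only [fillWith_update, (S z).map_update_add]
          map_update_smul' := fun a i c x => by
            simp only [fillWith_update, (S z).map_update_smul] }, fun a => rfl⟩
    have hd : ((d.factorial : ℂ) / 2 ^ d) ≠ 0 :=
      div_ne_zero (by exact_mod_cast d.factorial_ne_zero) (by simp)
    -- Subtract the leading term.
    set κ : ℂ := -((d.factorial : ℂ) / 2 ^ d)⁻¹ with hκ
    obtain ⟨f₁, hf₁⟩ := ih (fun z a => κ * R z a + T z a)
      (fun a => (contDiffOn_const.mul (hRsmooth a)).add (hT a))
      (fun z hz => by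
        obtain ⟨m₁, h₁⟩ := hRm z hz
        obtain ⟨m₂, h₂⟩ := hm z hz
        exact ⟨κ • m₁ + m₂, fun a => by simp [h₁, h₂]⟩)
      (fun z hz a => by
        rw [P.lowerIter_comb κ hRsmooth hT (fun z _ a => rfl) d z hz,
          P.lowerIter_fillWith_nu hol hsymm d le_rfl z hz, fillWith_self, hS z hz,
          Nat.descFactorial_self, ← mul_assoc, hκ, neg_mul, inv_mul_cancel₀ hd]
        ring)
    obtain ⟨f₂, hf₂⟩ := P.hasConstantTerm_fillWith_nu (s := s) hol
    exact ⟨_, HasConstantTerm.comb (-κ) hf₂ hf₁ (fun z _ a => by simp only [hR]; ring)⟩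

end HypPair

/-! ### Isotropic vectors and the affine cone -/

/-- A vector of the affine cone spans a positive definite real plane, so in signature `(2, n)` it
is not orthogonal to a real isotropic vector. -/
lemma form_realVec_ne_zero {Z : CVec n} (hZ : Z ∈ M.cone) {x x' : Fin (n + 2) → ℝ}
    (hxx : M.form (realVec x) (realVec x) = 0) (hxx' : M.form (realVec x) (realVec x') = 1) :
    M.form (realVec x) Z ≠ 0 := by
  intro h0
  set B := Matrix.toBilin' (M.gram.map (Int.cast : ℤ → ℝ)) with hB
  have hform : ∀ u v : Fin (n + 2) → ℝ, M.form (realVec u) (realVec v) = (B u v : ℂ) := by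
    intro u v
    rw [form_apply, hB, Matrix.toBilin'_apply]
    simp [realVec]
  have hcomm : ∀ u v, B u v = B v u := by
    intro u v
    have := M.form_comm (realVec u) (realVec v)
    rw [hform, hform] at this
    exact_mod_cast this
  set X : Fin (n + 2) → ℝ := fun i => (Z i).re with hX
  set Y : Fin (n + 2) → ℝ := fun i => (Z i).im with hY
  have hZXY : Z = realVec X + Complex.I • realVec Y := by
    ext i
    simp only [realVec, hX, hY, Pi.add_apply, Pi.smul_apply, smul_eq_mul]
    rw [mul_comm, Complex.re_add_im]
  have hZs : star Z = realVec X - Complex.I • realVec Y := by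
    ext i
    simp only [Pi.star_apply, hX, hY, realVec, Pi.sub_apply, Pi.smul_apply, smul_eq_mul]
    refine Complex.ext ?_ ?_ <;> simp
  have hxX : B x X = 0 ∧ B x Y = 0 := by
    rw [hZXY, map_add, map_smul, hform, hform, smul_eq_mul] at h0
    have h₁ := congrArg Complex.re h0
    have h₂ := congrArg Complex.im h0
    simp at h₁ h₂
    exact ⟨h₁, h₂⟩
  have hZZ : B X X = B Y Y ∧ B X Y = 0 := by
    have h := hZ.1
    rw [hZXY] at h
    simp only [map_add, map_smul, LinearMap.add_apply, LinearMap.smul_apply, hform,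
      smul_eq_mul, hcomm Y X] at h
    have h₁ := congrArg Complex.re h
    have h₂ := congrArg Complex.im h
    simp at h₁ h₂
    exact ⟨by linarith, by linarith⟩
  have hpos : 0 < B X X := by
    have h := hZ.2
    rw [hZs, hZXY] at h
    simp only [map_add, map_sub, map_smul, LinearMap.add_apply, LinearMap.smul_apply,
      hform, smul_eq_mul, hcomm Y X] at h
    simp at h
    linarith [hZZ.1]
  have hx : B x x = 0 := by rw [hform] at hxx; exact_mod_cast hxx
  have hx' : B x x' = 1 := by rw [hform] at hxx'; exact_mod_cast hxx'
  set p := B X X with hp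
  -- A vector of norm one orthogonal to the positive definite plane spanned by `X` and `Y`.
  set w := x' - (B x' X / p) • X - (B x' Y / p) • Y with hw
  set v := w + ((1 - B w w) / 2) • x with hv
  have hwX : B w X = 0 := by
    simp only [hw, map_sub, map_smul, LinearMap.sub_apply, LinearMap.smul_apply, smul_eq_mul,
      hcomm Y X, hZZ.2, ← hp]
    field_simp
    ring
  have hwY : B w Y = 0 := by
    simp only [hw, map_sub, map_smul, LinearMap.sub_apply, LinearMap.smul_apply, smul_eq_mul,
      hZZ.2, ← hZZ.1]
    field_simp
    ring
  have hwx : B w x = 1 := by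
    simp only [hw, map_sub, map_smul, LinearMap.sub_apply, LinearMap.smul_apply, smul_eq_mul,
      hcomm X x, hcomm Y x, hcomm x' x, hxX.1, hxX.2, hx']
    ring
  have hvX : B v X = 0 := by
    simp [hv, hwX, hxX.1]
  have hvY : B v Y = 0 := by
    simp [hv, hwY, hxX.2]
  have hvv : B v v = 1 := by
    simp only [hv, map_add, map_smul, LinearMap.add_apply, LinearMap.smul_apply, smul_eq_mul,
      hwx, hx, hcomm x w]
    ring
  let l : (Fin 3 → ℝ) →ₗ[ℝ] (Fin (n + 2) → ℝ) :=
    { toFun := fun c => c 0 • X + c 1 • Y + c 2 • v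
      map_add' := fun c d => by simp only [Pi.add_apply]; module
      map_smul' := fun r c => by simp only [Pi.smul_apply, smul_eq_mul, RingHom.id_apply]; module }
  have hl : ∀ c, B (l c) (l c) = p * (c 0 ^ 2 + c 1 ^ 2) + c 2 ^ 2 := by
    intro c
    change B (c 0 • X + c 1 • Y + c 2 • v) (c 0 • X + c 1 • Y + c 2 • v) = _
    simp only [map_add, map_smul, LinearMap.add_apply, LinearMap.smul_apply, smul_eq_mul,
      hcomm X v, hcomm Y v, hcomm Y X, hvX, hvY, hvv, hZZ.2, ← hZZ.1, ← hp]
    ring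
  have hl0 : ∀ c, B (l c) (l c) ≤ 0 → c = 0 := by
    intro c hc
    rw [hl] at hc
    have h₀ : c 0 ^ 2 + c 1 ^ 2 ≤ 0 := by
      by_contra hcon
      push Not at hcon
      nlinarith [mul_pos hpos hcon, sq_nonneg (c 2)]
    have h₂ : c 2 ^ 2 ≤ 0 := by
      nlinarith [mul_nonneg hpos.le (add_nonneg (sq_nonneg (c 0)) (sq_nonneg (c 1)))]
    have e₀ : c 0 = 0 := (pow_eq_zero_iff two_ne_zero).1
      (le_antisymm (by linarith [sq_nonneg (c 1)]) (sq_nonneg _))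
    have e₁ : c 1 = 0 := (pow_eq_zero_iff two_ne_zero).1
      (le_antisymm (by linarith [sq_nonneg (c 0)]) (sq_nonneg _))
    have e₂ : c 2 = 0 := (pow_eq_zero_iff two_ne_zero).1 (le_antisymm h₂ (sq_nonneg _))
    ext i
    fin_cases i
    exacts [e₀, e₁, e₂]
  have hinj : Function.Injective l := by
    rw [← LinearMap.ker_eq_bot, LinearMap.ker_eq_bot']
    intro c hc
    exact hl0 c (by rw [hc]; simp)
  have hrank := le_sigPos_of_posDef (Q := B.toQuadraticMap) (V := LinearMap.range l) (by
    rintro ⟨u, c, rfl⟩ hu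
    change 0 < B (l c) (l c)
    by_contra hcon
    refine hu (Subtype.ext ?_)
    change l c = 0
    rw [hl0 c (not_lt.1 hcon), map_zero])
  rw [LinearMap.finrank_range_of_inj hinj, Module.finrank_fin_fun, hB, M.sigPos_eq] at hrank
  omega

lemma subset_aff {S : Set (CVec n)} (hS : IsPreconnected S) (hc : S ⊆ M.cone) {Z : CVec n}
    (hZS : Z ∈ S) (hZ : Z ∈ M.aff Z₀) : S ⊆ M.aff Z₀ := by
  rw [aff, connectedComponentIn_eq hZ]
  exact hS.subset_connectedComponentIn hZS hc

lemma smul_mem_cone {Z : CVec n} (hZ : Z ∈ M.cone) {c : ℂ} (hc : c ≠ 0) : c • Z ∈ M.cone := by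
  refine ⟨by simp [hZ.1], ?_⟩
  have h : M.form (c • Z) (star (c • Z)) = (Complex.normSq c : ℂ) * M.form Z (star Z) := by
    rw [star_smul, map_smul, map_smul, LinearMap.smul_apply, ← Complex.mul_conj]
    simp
    ring
  rw [h, Complex.re_ofReal_mul]
  exact mul_pos (Complex.normSq_pos.2 hc) hZ.2

lemma smul_mem_aff {Z : CVec n} (hZ : Z ∈ M.aff Z₀) {c : ℂ} (hc : c ≠ 0) :
    c • Z ∈ M.aff Z₀ := by
  have hconn : IsPreconnected ({0}ᶜ : Set ℂ) :=
    (isConnected_compl_singleton_of_one_lt_rank (by simp) 0).isPreconnected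
  refine subset_aff (hconn.image (fun c : ℂ => c • Z)
    (continuous_id.smul continuous_const).continuousOn) ?_ ⟨1, by simp, one_smul _ _⟩ hZ
    ⟨c, hc, rfl⟩
  rintro _ ⟨c, hc, rfl⟩
  exact smul_mem_cone (connectedComponentIn_subset _ _ hZ) hc

namespace HypPair

variable (P : M.HypPair)

lemma form_e_ne_zero {Z : CVec n} (hZ : Z ∈ M.aff Z₀) : M.form (realVec P.e) Z ≠ 0 :=
  form_realVec_ne_zero (connectedComponentIn_subset _ _ hZ) P.ee P.ef

lemma form_f_ne_zero {Z : CVec n} (hZ : Z ∈ M.aff Z₀) : M.form (realVec P.f) Z ≠ 0 :=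
  form_realVec_ne_zero (connectedComponentIn_subset _ _ hZ) P.ff
    (by rw [M.form_comm]; exact P.ef)

/-! ### Eichler transvections along `f` -/

/-- The Eichler transvection `exp(ξ ∧ f)`,
`x ↦ x + ⟨f, x⟩ ξ - ⟨ξ, x⟩ f - ½ ⟨ξ, ξ⟩ ⟨f, x⟩ f`. -/
noncomputable def eichler (ξ : P.LC) : CVec n →ₗ[ℂ] CVec n :=
  LinearMap.id + (M.form (realVec P.f)).smulRight (ξ : CVec n) -
    (M.form (ξ : CVec n)).smulRight (realVec P.f) -
    ((1 / 2 : ℂ) * P.ip ξ ξ) • (M.form (realVec P.f)).smulRight (realVec P.f)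

lemma eichler_apply (ξ : P.LC) (x : CVec n) : P.eichler ξ x =
    x + M.form (realVec P.f) x • (ξ : CVec n) - M.form (ξ : CVec n) x • realVec P.f -
      ((1 / 2 : ℂ) * P.ip ξ ξ * M.form (realVec P.f) x) • realVec P.f := by
  simp [eichler, smul_smul]

lemma form_LC_f (ξ : P.LC) : M.form (ξ : CVec n) (realVec P.f) = 0 := by
  rw [M.form_comm]; exact P.form_f_LC ξ

lemma form_LC_e (ξ : P.LC) : M.form (ξ : CVec n) (realVec P.e) = 0 := by
  rw [M.form_comm]; exact P.form_e_LC ξ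

lemma form_eichler (ξ : P.LC) (x y : CVec n) :
    M.form (P.eichler ξ x) (P.eichler ξ y) = M.form x y := by
  have h₁ : M.form (ξ : CVec n) (ξ : CVec n) = P.ip ξ ξ := rfl
  simp only [eichler_apply, map_add, map_sub, map_smul, LinearMap.add_apply, LinearMap.sub_apply,
    LinearMap.smul_apply, smul_eq_mul, form_LC_f, form_f_LC, P.ff, h₁, M.form_comm x ξ,
    M.form_comm x (realVec P.f)]
  ring

lemma eichler_add (ξ η : P.LC) (x : CVec n) :
    P.eichler (ξ + η) x = P.eichler ξ (P.eichler η x) := by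
  have h₁ : M.form (ξ : CVec n) (η : CVec n) = P.ip ξ η := rfl
  simp only [eichler_apply, map_add, map_sub, map_smul, LinearMap.add_apply,
    form_LC_f, form_f_LC, P.ff, h₁, ip_add_left, ip_add_right, P.ip_comm η ξ, Submodule.coe_add]
  module

lemma eichler_zero (x : CVec n) : P.eichler 0 x = x := by
  simp [eichler_apply]

lemma star_eichler {ξ : P.LC} (hξ : P.bar ξ = ξ) (x : CVec n) :
    star (P.eichler ξ x) = P.eichler ξ (star x) := by
  have h₀ : star (ξ : CVec n) = ξ := congrArg Subtype.val hξ
  have h₁ : conj (P.ip ξ ξ) = P.ip ξ ξ := by rw [← P.ip_bar_bar, hξ]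
  have h₂ : conj (M.form (realVec P.f) x) = M.form (realVec P.f) (star x) := by
    rw [← M.form_star, star_realVec]
  have h₃ : conj (M.form (ξ : CVec n) x) = M.form (ξ : CVec n) (star x) := by
    rw [← M.form_star, h₀]
  simp only [eichler_apply, star_add, star_sub, star_smul, star_realVec, h₀, star_mul',
    Complex.star_def, h₁, h₂, h₃]
  simp [map_ofNat]

lemma eichler_mem_cone {ξ : P.LC} (hξ : P.bar ξ = ξ) {Z : CVec n} (hZ : Z ∈ M.cone) :
    P.eichler ξ Z ∈ M.cone :=
  ⟨by rw [form_eichler, hZ.1], by rw [P.star_eichler hξ, form_eichler]; exact hZ.2⟩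

lemma eichler_mem_aff {ξ : P.LC} (hξ : P.bar ξ = ξ) {Z : CVec n} (hZ : Z ∈ M.aff Z₀) :
    P.eichler ξ Z ∈ M.aff Z₀ := by
  have hcont : Continuous fun t : ℝ => P.eichler ((t : ℂ) • ξ) Z := by
    simp only [eichler_apply, ip_smul_left, ip_smul_right, Submodule.coe_smul, map_smul,
      LinearMap.smul_apply]
    fun_prop
  refine subset_aff (isPreconnected_univ.image (fun t : ℝ => P.eichler ((t : ℂ) • ξ) Z)
    hcont.continuousOn) ?_ ⟨0, trivial, by simp [eichler_zero]⟩ hZ ⟨1, trivial, by simp⟩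
  rintro _ ⟨t, -, rfl⟩
  exact P.eichler_mem_cone (by simp [hξ]) (connectedComponentIn_subset _ _ hZ)

lemma eichler_mem_aff_iff {ξ : P.LC} (hξ : P.bar ξ = ξ) {Z : CVec n} :
    P.eichler ξ Z ∈ M.aff Z₀ ↔ Z ∈ M.aff Z₀ := by
  refine ⟨fun h => ?_, P.eichler_mem_aff hξ⟩
  have := P.eichler_mem_aff (ξ := (-1 : ℂ) • ξ) (by simp [hξ]) h
  rwa [← eichler_add, show (-1 : ℂ) • ξ + ξ = 0 by module, eichler_zero] at this

/-- The lattice `L ⊆ L_ℂ` of integral vectors. -/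
def latticeL : AddSubgroup P.LC where
  carrier := {η | ∃ m : Fin (n + 2) → ℤ, ∀ i, (η : CVec n) i = m i}
  zero_mem' := ⟨0, by simp⟩
  add_mem' := by
    rintro η ξ ⟨m, hm⟩ ⟨k, hk⟩
    exact ⟨m + k, fun i => by simp [hm, hk]⟩
  neg_mem' := by
    rintro η ⟨m, hm⟩
    exact ⟨-m, fun i => by simp [hm]⟩

variable {P}

lemma bar_of_mem_latticeL {η : P.LC} (hη : η ∈ P.latticeL) : P.bar η = η := by
  obtain ⟨m, hm⟩ := hη
  ext i
  simp [bar, hm]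

/-- As `M = U ⊕ L`, the lattice `L` spans `L_ℂ`. -/
lemma span_latticeL (hP : P.IsIntegral) (z : P.LC) :
    z ∈ Submodule.span ℂ (P.latticeL : Set P.LC) := by
  obtain ⟨he, hf⟩ := hP
  choose e he using he
  choose f hf using hf
  have hfe : M.form (realVec P.f) (realVec P.e) = 1 := by rw [M.form_comm]; exact P.ef
  -- The orthogonal projection to `L_ℂ`.
  let π : CVec n →ₗ[ℂ] P.LC := LinearMap.codRestrict P.LC
    (LinearMap.id - (M.form (realVec P.f)).smulRight (realVec P.e) -
      (M.form (realVec P.e)).smulRight (realVec P.f)) (fun x => by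
        simp [LC, P.ee, P.ff, P.ef, hfe])
  have hπ : ∀ x, ((π x : P.LC) : CVec n) = x - M.form (realVec P.f) x • realVec P.e -
      M.form (realVec P.e) x • realVec P.f := fun x => rfl
  have hz : π z = z := by
    ext i
    rw [hπ, P.form_e_LC, P.form_f_LC]
    simp
  rw [← hz, ← Finset.univ_sum_single (z : CVec n), map_sum]
  refine Submodule.sum_mem _ fun i _ => ?_
  have : Pi.single i ((z : CVec n) i) = (z : CVec n) i • (Pi.single i 1 : CVec n) := by
    rw [← Pi.single_smul, smul_eq_mul, mul_one]
  rw [this, map_smul]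
  refine Submodule.smul_mem _ _ (Submodule.subset_span ?_)
  refine ⟨fun j => (Pi.single i 1 : Fin (n + 2) → ℤ) j - (∑ k, f k * M.gram k i) * e j -
    (∑ k, e k * M.gram k i) * f j, fun j => ?_⟩
  rw [hπ]
  have h₁ : ∀ x : Fin (n + 2) → ℝ, M.form (realVec x) (Pi.single i 1) =
      ∑ k, (x k : ℂ) * M.gram k i := by
    intro x
    rw [form_apply]
    refine Finset.sum_congr rfl fun k _ => ?_
    rw [Finset.sum_eq_single i (fun l _ hl => by simp [hl]) (by simp)]
    simp [realVec]
  rw [h₁, h₁]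
  simp [realVec, he, hf, Pi.single_apply]

/-- For `η ∈ L` the transvection `exp(2 η ∧ f)` belongs to `O⁺(M)`. -/
lemma exists_act_eq_eichler (hP : P.IsIntegral) {η : P.LC} (hη : η ∈ P.latticeL) :
    ∃ γ : M.OPlus Z₀, ∀ x, act (γ : GL (Fin (n + 2)) ℤ) x = P.eichler ((2 : ℂ) • η) x := by
  obtain ⟨f, hf⟩ := Classical.axiom_of_choice hP.2
  -- The matrix of the transvection by an integral vector.
  have hmat : ∀ η ∈ P.latticeL, ∃ A : Matrix (Fin (n + 2)) (Fin (n + 2)) ℤ,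
      ∀ x, (A.map (Int.cast : ℤ → ℂ)).mulVec x = P.eichler ((2 : ℂ) • η) x := by
    rintro η ⟨m, hm⟩
    let u : Fin (n + 2) → ℤ := fun j => ∑ k, f k * M.gram k j
    let v : Fin (n + 2) → ℤ := fun j => ∑ k, m k * M.gram k j
    let q : ℤ := ∑ i, v i * m i
    have hu : ∀ x, M.form (realVec P.f) x = ∑ j, (u j : ℂ) * x j := by
      intro x
      rw [form_apply, Finset.sum_comm]
      simp [u, realVec, hf, Finset.sum_mul]
    have hv : ∀ x, M.form (η : CVec n) x = ∑ j, (v j : ℂ) * x j := by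
      intro x
      rw [form_apply, Finset.sum_comm]
      simp [v, hm, Finset.sum_mul]
    have hq : P.ip η η = q := by
      rw [ip, hv]
      simp [q, hm]
    refine ⟨1 + Matrix.of fun i j => 2 * m i * u j - 2 * f i * v j - 2 * q * f i * u j,
      fun x => ?_⟩
    ext i
    simp only [eichler_apply, ip_smul_left, ip_smul_right, hq, Submodule.coe_smul, map_smul,
      LinearMap.smul_apply, hu, hv, Pi.add_apply, Pi.sub_apply, Pi.smul_apply, smul_eq_mul, hm,
      realVec, hf, Matrix.mulVec, dotProduct, Matrix.map_apply, Matrix.add_apply, Matrix.of_apply]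
    push_cast
    simp only [add_mul, sub_mul, Finset.sum_add_distrib, Finset.sum_sub_distrib, mul_assoc,
      ← Finset.mul_sum]
    rw [show ∑ j, (((1 : Matrix (Fin (n + 2)) (Fin (n + 2)) ℤ) i j : ℤ) : ℂ) * x j = x i by
      simp [Matrix.one_apply]]
    ring
  obtain ⟨A, hA⟩ := hmat η hη
  obtain ⟨A', hA'⟩ := hmat (-η) (neg_mem hη)
  have hcast : ∀ C D : Matrix (Fin (n + 2)) (Fin (n + 2)) ℤ,
      (∀ x, (C.map (Int.cast : ℤ → ℂ)).mulVec ((D.map (Int.cast : ℤ → ℂ)).mulVec x) = x) →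
      C * D = 1 := by
    intro C D h
    have h₁ : (C * D).map (Int.cast : ℤ → ℂ) = (1 : Matrix _ _ ℤ).map (Int.cast : ℤ → ℂ) := by
      have h₂ : (C * D).map (Int.cast : ℤ → ℂ) =
          C.map (Int.cast : ℤ → ℂ) * D.map (Int.cast : ℤ → ℂ) :=
        Matrix.map_mul (f := Int.castRingHom ℂ)
      rw [h₂, Matrix.map_one _ Int.cast_zero Int.cast_one]
      refine Matrix.mulVec_injective (funext fun x => ?_)
      rw [← Matrix.mulVec_mulVec, h, Matrix.one_mulVec]
    exact Matrix.map_injective Int.cast_injective h₁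
  have h₁ : A * A' = 1 := hcast _ _ fun x => by
    rw [hA, hA', ← eichler_add, smul_neg, add_neg_cancel, eichler_zero]
  have h₂ : A' * A = 1 := hcast _ _ fun x => by
    rw [hA, hA', ← eichler_add, smul_neg, neg_add_cancel, eichler_zero]
  let γ : GL (Fin (n + 2)) ℤ := ⟨A, A', h₁, h₂⟩
  have hγ : ∀ x, act γ x = P.eichler ((2 : ℂ) • η) x := hA
  refine ⟨⟨γ, ?_, fun Z => ?_⟩, hγ⟩
  · change A.transpose * M.gram * A = M.gram
    have h₃ : ((A.transpose * M.gram * A).map (Int.cast : ℤ → ℂ)) =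
        M.gram.map (Int.cast : ℤ → ℂ) := by
      have h₄ : (A.transpose * M.gram * A).map (Int.cast : ℤ → ℂ) =
          (A.map (Int.cast : ℤ → ℂ)).transpose * M.gram.map (Int.cast : ℤ → ℂ) *
            A.map (Int.cast : ℤ → ℂ) := by
        have e₁ := Matrix.map_mul (L := A.transpose * M.gram) (M := A) (f := Int.castRingHom ℂ)
        have e₂ := Matrix.map_mul (L := A.transpose) (M := M.gram) (f := Int.castRingHom ℂ)
        rw [e₂] at e₁
        exact e₁
      rw [h₄]
      apply Matrix.toBilin'.injective
      refine LinearMap.ext fun x => LinearMap.ext fun y => ?_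
      have h₅ := P.form_eichler ((2 : ℂ) • η) x y
      rw [← hA, ← hA] at h₅
      rw [Matrix.toBilin'_apply', ← Matrix.mulVec_mulVec, ← Matrix.mulVec_mulVec,
        Matrix.dotProduct_mulVec, Matrix.vecMul_transpose]
      simpa only [form, Matrix.toBilin'_apply'] using h₅
    exact Matrix.map_injective Int.cast_injective h₃
  · rw [hγ]
    exact P.eichler_mem_aff_iff (by rw [bar_smul, bar_of_mem_latticeL hη, map_ofNat])

/-- A subgroup of finite index contains, for every `η ∈ L`, the transvections by the multiples of
some non-zero multiple of `η`. -/
lemma exists_multiples_act_eq_eichler (hP : P.IsIntegral) (Γ : Subgroup (M.OPlus Z₀))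
    (hΓ : Γ.FiniteIndex) {η : P.LC} (hη : η ∈ P.latticeL) :
    ∃ N : ℕ, N ≠ 0 ∧ ∀ m : ℕ, ∃ γ ∈ Γ, ∀ x,
      act (γ : GL (Fin (n + 2)) ℤ) x = P.eichler (((N : ℂ) * m) • η) x := by
  obtain ⟨γ, hγ⟩ := exists_act_eq_eichler (Z₀ := Z₀) hP hη
  obtain ⟨N, hN, -, hmem⟩ := Subgroup.exists_pow_mem_of_index_ne_zero hΓ.index_ne_zero γ
  have hpow : ∀ k : ℕ, ∀ x, act ((γ ^ k : M.OPlus Z₀) : GL (Fin (n + 2)) ℤ) x =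
      P.eichler ((2 * (k : ℂ)) • η) x := by
    intro k
    induction k with
    | zero => intro x; simp [act_one, eichler_zero]
    | succ k ih =>
      intro x
      rw [pow_succ, Subgroup.coe_mul, act_mul, hγ, ih, ← eichler_add,
        show (2 * ((k + 1 : ℕ) : ℂ)) • η = (2 * (k : ℂ)) • η + (2 : ℂ) • η by push_cast; module]
  refine ⟨2 * N, by omega, fun m => ⟨(γ ^ N) ^ m, Γ.pow_mem hmem m, fun x => ?_⟩⟩
  rw [← pow_mul, hpow]
  push_cast
  rw [mul_assoc]

variable (P)

/-! ### The action of the transvections on the tube domain -/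

/-- The automorphy factor of `exp(ξ ∧ f)`, the coefficient of `f` in `exp(ξ ∧ f) φ̃(z)`. -/
noncomputable def autFactor (ξ z : P.LC) : ℂ := 1 - P.ip ξ z + 1 / 4 * P.ip ξ ξ * P.ip z z

/-- The action `z ↦ (z - ½ ⟨z, z⟩ ξ) / j(z)` of `exp(ξ ∧ f)` on the tube domain. -/
noncomputable def moebius (ξ z : P.LC) : P.LC :=
  (P.autFactor ξ z)⁻¹ • (z - (1 / 2 * P.ip z z) • ξ)

/-- The derivative of the automorphy factor of `exp(ξ ∧ f)` at `z` in the direction `a`. -/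
noncomputable def autFactorDeriv (ξ z a : P.LC) : ℂ := -P.ip ξ a + 1 / 2 * P.ip ξ ξ * P.ip z a

/-- The automorphy factor of `exp(ξ ∧ f)` times the derivative of its action at `z`. -/
noncomputable def moebiusDeriv (ξ z : P.LC) : P.LC →ₗ[ℂ] P.LC where
  toFun a := a - P.ip z a • ξ - P.autFactorDeriv ξ z a • P.moebius ξ z
  map_add' a b := by
    simp only [autFactorDeriv, ip_add_right]
    module
  map_smul' c a := by
    simp only [autFactorDeriv, ip_smul_right, RingHom.id_apply]
    module

lemma moebiusDeriv_apply (ξ z a : P.LC) : P.moebiusDeriv ξ z a =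
    a - P.ip z a • ξ - P.autFactorDeriv ξ z a • P.moebius ξ z := rfl

/-- The vector dual to the derivative of the automorphy factor of `exp(ξ ∧ f)`. -/
noncomputable def autFactorGrad (ξ z : P.LC) : P.LC := -ξ + (1 / 2 * P.ip ξ ξ) • z

lemma ip_moebius_moebius {ξ z : P.LC} (hj : P.autFactor ξ z ≠ 0) :
    P.ip (P.moebius ξ z) (P.moebius ξ z) = P.ip z z / P.autFactor ξ z := by
  simp only [moebius, ip_smul_left, ip_smul_right, ip_sub_left, ip_sub_right, P.ip_comm z ξ]
  field_simp
  rw [autFactor]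
  ring

lemma eichler_phi {ξ z : P.LC} (hj : P.autFactor ξ z ≠ 0) :
    P.eichler ξ (P.phi z) = P.autFactor ξ z • P.phi (P.moebius ξ z) := by
  have h₁ : M.form (ξ : CVec n) (z : CVec n) = P.ip ξ z := rfl
  have hfe : M.form (realVec P.f) (realVec P.e) = 1 := by rw [M.form_comm]; exact P.ef
  have h₂ : P.autFactor ξ z • ((P.moebius ξ z : P.LC) : CVec n) =
      (z : CVec n) - (1 / 2 * P.ip z z) • (ξ : CVec n) := by
    rw [moebius, ← Submodule.coe_smul, smul_smul, mul_inv_cancel₀ hj, one_smul]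
    rfl
  rw [phi, phi, smul_add, smul_add, h₂, P.ip_moebius_moebius hj, smul_smul]
  simp only [eichler_apply, map_add, map_smul, form_f_LC, form_LC_f, form_LC_e, P.ff,
    hfe, h₁]
  rw [show P.autFactor ξ z * (-(1 / 2) * (P.ip z z / P.autFactor ξ z)) = -(1 / 2) * P.ip z z by
    field_simp, autFactor]
  module

lemma eichler_dphi {ξ z : P.LC} (hj : P.autFactor ξ z ≠ 0) (a : P.LC) :
    P.eichler ξ (P.dphi z a) = P.dphi (P.moebius ξ z) (P.moebiusDeriv ξ z a) +
      P.autFactorDeriv ξ z a • P.phi (P.moebius ξ z) := by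
  have h₁ : M.form (ξ : CVec n) (a : CVec n) = P.ip ξ a := rfl
  have hfe : M.form (realVec P.f) (realVec P.e) = 1 := by rw [M.form_comm]; exact P.ef
  have h₂ : P.ip (P.moebius ξ z) (P.moebiusDeriv ξ z a) =
      P.ip z a - 1 / 2 * P.autFactorDeriv ξ z a * P.ip (P.moebius ξ z) (P.moebius ξ z) := by
    rw [moebiusDeriv_apply, ip_sub_right, ip_sub_right, ip_smul_right, ip_smul_right,
      P.ip_moebius_moebius hj]
    simp only [moebius, ip_smul_left, ip_sub_left, P.ip_comm z ξ]
    field_simp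
    simp only [autFactor, autFactorDeriv]
    ring
  rw [dphi, dphi, phi, h₂]
  simp only [moebiusDeriv_apply, eichler_apply, map_add, map_smul, form_f_LC,
    form_LC_e, hfe, h₁, Submodule.coe_sub, Submodule.coe_smul]
  simp only [autFactorDeriv]
  module

lemma autFactor_ne_zero {ξ z : P.LC} (hξ : P.bar ξ = ξ) (hz : z ∈ P.tube Z₀) :
    P.autFactor ξ z ≠ 0 := by
  have h := P.form_e_ne_zero (P.eichler_mem_aff hξ hz)
  have h₁ : M.form (ξ : CVec n) (z : CVec n) = P.ip ξ z := rfl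
  have hfe : M.form (realVec P.f) (realVec P.e) = 1 := by rw [M.form_comm]; exact P.ef
  convert h using 1
  simp only [autFactor, phi, eichler_apply, map_add, map_sub, map_smul, smul_eq_mul, form_f_LC,
    form_e_LC, form_LC_f, form_LC_e, P.ff, P.ee, P.ef, hfe, h₁]
  ring

lemma moebius_mem_tube {ξ z : P.LC} (hξ : P.bar ξ = ξ) (hz : z ∈ P.tube Z₀) :
    P.moebius ξ z ∈ P.tube Z₀ := by
  have hj := P.autFactor_ne_zero hξ hz
  have h := smul_mem_aff (P.eichler_mem_aff hξ hz) (inv_ne_zero hj)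
  rwa [P.eichler_phi hj, smul_smul, inv_mul_cancel₀ hj, one_smul] at h

lemma ip_sub_bar (z : P.LC) :
    P.ip (z - P.bar z) (z - P.bar z) = -4 * P.ip (P.imag z) (P.imag z) := by
  rw [sub_bar, ip_smul_left, ip_smul_right]
  linear_combination 4 * P.ip (P.imag z) (P.imag z) * Complex.I_sq

lemma nu_eq (z : P.LC) :
    P.nu z = (2 / P.ip (z - P.bar z) (z - P.bar z)) • (z - P.bar z) := by
  rw [ip_sub_bar, sub_bar, nu, smul_smul]
  congr 1
  rw [div_mul_eq_mul_div, neg_mul, div_neg, show (2 : ℂ) * (2 * Complex.I) = 4 * Complex.I by ring,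
    mul_div_mul_left _ _ (by norm_num : (4 : ℂ) ≠ 0), neg_div]

/-- The action of a real transvection commutes with complex conjugation. -/
lemma bar_moebius {ξ : P.LC} (hξ : P.bar ξ = ξ) (z : P.LC) :
    P.autFactor ξ (P.bar z) = conj (P.autFactor ξ z) ∧
      P.bar (P.moebius ξ z) = P.moebius ξ (P.bar z) := by
  have h : ∀ w, P.ip ξ (P.bar w) = conj (P.ip ξ w) := fun w => by
    rw [← P.ip_bar_bar, hξ]
  have hξξ : conj (P.ip ξ ξ) = P.ip ξ ξ := by rw [← P.ip_bar_bar, hξ]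
  have h₁ : P.autFactor ξ (P.bar z) = conj (P.autFactor ξ z) := by
    simp [autFactor, h, hξξ, ip_bar_bar, map_ofNat]
  refine ⟨h₁, ?_⟩
  simp [moebius, h₁, hξ, ip_bar_bar, map_ofNat]

/-- The affine transformation law of `ν` under the transvections. -/
lemma nu_moebius {ξ z : P.LC} (hξ : P.bar ξ = ξ) (hz : z ∈ P.tube Z₀) :
    P.nu (P.moebius ξ z) =
      P.moebiusDeriv ξ z (P.autFactor ξ z • P.nu z - P.autFactorGrad ξ z) := by
  have hj := P.autFactor_ne_zero hξ hz
  obtain ⟨hjw, hσw⟩ := P.bar_moebius hξ z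
  have hjw0 : P.autFactor ξ (P.bar z) ≠ 0 := by
    rw [hjw]
    exact (map_ne_zero _).2 hj
  have hD : P.ip (z - P.bar z) (z - P.bar z) ≠ 0 := by
    rw [ip_sub_bar]
    exact mul_ne_zero (by norm_num) (P.ip_imag_imag_ne_zero hz)
  rw [P.nu_eq, P.nu_eq, hσw]
  set w := P.bar z with hw
  have hu : P.ip (z - w) (z - w) = P.ip z z - 2 * P.ip z w + P.ip w w := by
    rw [ip_sub_left, ip_sub_right, ip_sub_right, P.ip_comm w z]
    ring
  have hσ : P.ip (P.moebius ξ z - P.moebius ξ w) (P.moebius ξ z - P.moebius ξ w) =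
      P.ip (z - w) (z - w) / (P.autFactor ξ z * P.autFactor ξ w) := by
    have h₁ : P.ip (P.moebius ξ z) (P.moebius ξ w) =
        (P.ip z w - 1 / 2 * P.ip w w * P.ip ξ z - 1 / 2 * P.ip z z * P.ip ξ w +
          1 / 4 * P.ip z z * P.ip w w * P.ip ξ ξ) / (P.autFactor ξ z * P.autFactor ξ w) := by
      simp only [moebius, ip_smul_left, ip_smul_right, ip_sub_left, ip_sub_right, P.ip_comm z ξ]
      field_simp
      ring
    rw [ip_sub_left, ip_sub_right, ip_sub_right, P.ip_comm (P.moebius ξ w),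
      P.ip_moebius_moebius hj, P.ip_moebius_moebius hjw0, h₁, hu]
    field_simp
    simp only [autFactor]
    ring
  set D := P.ip (z - w) (z - w) with hDdef
  rw [hσ, moebiusDeriv_apply]
  have hs : ∀ x, P.ip x (P.autFactor ξ z • (2 / D) • (z - w) - P.autFactorGrad ξ z) =
      2 * P.autFactor ξ z / D * (P.ip x z - P.ip x w) -
        (-P.ip x ξ + 1 / 2 * P.ip ξ ξ * P.ip x z) := by
    intro x
    simp only [autFactorGrad, ip_sub_right, ip_smul_right, ip_add_right, ip_neg_right]
    field_simp
  rw [autFactorDeriv, hs, hs, P.ip_comm z ξ]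
  have hDne : P.ip z z - 2 * P.ip z w + P.ip w w ≠ 0 := hu ▸ hD
  simp only [moebius, autFactorGrad]
  rw [hu]
  match_scalars
  · field_simp
    simp only [autFactor]
    ring
  · field_simp
    simp only [autFactor]
    ring
  · field_simp

end HypPair

lemma hodgeMk_eq {Z u v : CVec n} (hu : u ∈ M.perp Z) (hv : v ∈ M.perp Z) (c : ℂ)
    (h : u - v = c • Z) : M.hodgeMk Z u hu = M.hodgeMk Z v hv := by
  refine (Submodule.Quotient.eq _).2 ?_
  rw [Submodule.mem_comap]
  exact Submodule.mem_span_singleton.2 ⟨c, h.symm⟩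

lemma hodgeMk_surjective {Z : CVec n} (x : M.HodgeE Z) :
    ∃ u, ∃ hu : u ∈ M.perp Z, M.hodgeMk Z u hu = x := by
  obtain ⟨⟨u, hu⟩, rfl⟩ := Submodule.Quotient.mk_surjective _ x
  exact ⟨u, hu, rfl⟩

namespace HypPair

variable (P : M.HypPair)

/-! ### Sections in the trivialisation over the tube domain -/

lemma dphi_add (z a b : P.LC) : P.dphi z (a + b) = P.dphi z a + P.dphi z b := by
  simp only [dphi, ip_add_right, Submodule.coe_add]
  module

lemma dphi_smul (z : P.LC) (c : ℂ) (a : P.LC) : P.dphi z (c • a) = c • P.dphi z a := by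
  simp only [dphi, ip_smul_right, Submodule.coe_smul]
  module

lemma pull_multilinear {s : ℕ} (F : M.HodgeSection Z₀ s) {z : P.LC} (hz : z ∈ P.tube Z₀) :
    ∃ m : MultilinearMap ℂ (fun _ : Fin s => P.LC) ℂ, ∀ a, P.pull F z a = m a := by
  let δ : P.LC →ₗ[ℂ] CVec n :=
    { toFun := P.dphi z
      map_add' := P.dphi_add z
      map_smul' := P.dphi_smul z }
  let l : P.LC →ₗ[ℂ] M.HodgeE (P.phi z) :=
    (Submodule.mkQ _).comp (δ.codRestrict (M.perp (P.phi z)) (P.dphi_mem z))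
  refine ⟨(F ⟨P.phi z, hz⟩).compLinearMap fun _ => l, fun a => ?_⟩
  rw [pull, dif_pos (show P.phi z ∈ M.aff Z₀ from hz)]
  rfl

/-- Invariance under a transvection, in the trivialisation over the tube domain. -/
lemma pull_moebius {s : ℕ} {k : ℤ} {F : M.HodgeSection Z₀ s} (hF : IsHomog k F)
    {γ : GL (Fin (n + 2)) ℤ} (hγF : IsInvariant γ F) {ξ : P.LC} (hξ : P.bar ξ = ξ)
    (hγ : ∀ x, act γ x = P.eichler ξ x) {z : P.LC} (hz : z ∈ P.tube Z₀) (a : Fin s → P.LC) :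
    P.pull F z a = P.autFactor ξ z ^ (-k) *
      P.pull F (P.moebius ξ z) (fun i => P.moebiusDeriv ξ z (a i)) := by
  have hj := P.autFactor_ne_zero hξ hz
  have hσ := P.moebius_mem_tube hξ hz
  have hZ' : P.eichler ξ (P.phi z) ∈ M.aff Z₀ := P.eichler_mem_aff hξ hz
  have hu : ∀ i, act γ (P.dphi z (a i)) ∈ M.perp (P.eichler ξ (P.phi z)) := fun i => by
    rw [hγ, LinearMap.mem_ker, form_eichler]
    exact P.dphi_mem z (a i)
  have hu' : ∀ i, act γ (P.dphi z (a i)) ∈ M.perp (P.phi (P.moebius ξ z)) := fun i => by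
    have h := hu i
    rw [LinearMap.mem_ker, P.eichler_phi hj, map_smul, LinearMap.smul_apply, smul_eq_mul] at h
    exact (mul_eq_zero.1 h).resolve_left hj
  have h₁ := hγF ⟨P.phi z, hz⟩ ⟨_, hZ'⟩ (hγ _).symm (fun i => P.dphi z (a i))
    (fun i => P.dphi_mem z (a i)) hu
  have h₂ := hF ⟨P.phi (P.moebius ξ z), hσ⟩ ⟨_, hZ'⟩ (P.autFactor ξ z) (P.eichler_phi hj)
    (fun i => act γ (P.dphi z (a i))) hu' hu
  rw [pull, dif_pos (show P.phi z ∈ M.aff Z₀ from hz), pull,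
    dif_pos (show P.phi (P.moebius ξ z) ∈ M.aff Z₀ from hσ), ← h₁, h₂]
  congr 2
  funext i
  refine hodgeMk_eq _ _ (P.autFactorDeriv ξ z (a i)) ?_
  rw [hγ, P.eichler_dphi hj, add_sub_cancel_left]

/-- A homogeneous section vanishing on the tube domain is zero, since `φ̃` meets every line of `𝓓`
and `dφ̃` is onto the fibres of `𝓔`. -/
lemma eq_zero_of_pull_eq_zero {s : ℕ} {k : ℤ} {F : M.HodgeSection Z₀ s} (hF : IsHomog k F)
    (h : ∀ z ∈ P.tube Z₀, ∀ a, P.pull F z a = 0) : F = 0 := by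
  have hfe : M.form (realVec P.f) (realVec P.e) = 1 := by rw [M.form_comm]; exact P.ef
  -- The `L_ℂ`-component of a vector.
  have hdec : ∀ x : CVec n, ∃ b : P.LC, x = M.form (realVec P.f) x • realVec P.e + (b : CVec n) +
      M.form (realVec P.e) x • realVec P.f := by
    intro x
    refine ⟨⟨x - M.form (realVec P.f) x • realVec P.e - M.form (realVec P.e) x • realVec P.f, ?_⟩,
      ?_⟩
    · simp [LC, P.ee, P.ff, P.ef, hfe]
    · simp only
      module
  funext Z
  obtain ⟨Z, hZ⟩ := Z
  set κ := M.form (realVec P.e) Z with hκ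
  have hκ0 : κ ≠ 0 := P.form_e_ne_zero hZ
  have hZ₁ : κ⁻¹ • Z ∈ M.aff Z₀ := smul_mem_aff hZ (inv_ne_zero hκ0)
  obtain ⟨z, hz⟩ := hdec (κ⁻¹ • Z)
  have he : M.form (realVec P.e) (κ⁻¹ • Z) = 1 := by
    rw [map_smul, smul_eq_mul, ← hκ, inv_mul_cancel₀ hκ0]
  have hphi : P.phi z = κ⁻¹ • Z := by
    have hnorm := (connectedComponentIn_subset _ _ hZ₁).1
    have hzz : M.form (z : CVec n) (z : CVec n) = P.ip z z := rfl
    set β := M.form (realVec P.f) (κ⁻¹ • Z) with hβ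
    rw [he, one_smul] at hz
    rw [hz] at hnorm
    simp only [map_add, map_smul, LinearMap.add_apply, LinearMap.smul_apply, smul_eq_mul, P.ee,
      P.ef, P.ff, hfe, form_e_LC, form_f_LC, form_LC_e, form_LC_f, hzz] at hnorm
    have hβ' : β = -(1 / 2) * P.ip z z := by linear_combination (1 / 2) * hnorm
    rw [hz, hβ', phi]
  have hzt : z ∈ P.tube Z₀ := by
    change P.phi z ∈ M.aff Z₀
    rwa [hphi]
  ext v
  choose u hu huv using fun i => hodgeMk_surjective (v i)
  have hu' : ∀ i, u i ∈ M.perp (P.phi z) := fun i => by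
    rw [LinearMap.mem_ker, hphi, map_smul, LinearMap.smul_apply, LinearMap.mem_ker.1 (hu i),
      smul_zero]
  have h₁ := hF ⟨P.phi z, hzt⟩ ⟨Z, hZ⟩ κ (by
    change Z = κ • P.phi z
    rw [hphi, smul_smul, mul_inv_cancel₀ hκ0, one_smul]) u hu' hu
  -- Every class is represented by some `dφ̃(a)`.
  have h₂ : ∀ i, ∃ a : P.LC, M.hodgeMk (P.phi z) (u i) (hu' i) =
      M.hodgeMk (P.phi z) (P.dphi z a) (P.dphi_mem z a) := by
    intro i
    set β := M.form (realVec P.e) (u i) with hβ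
    obtain ⟨a, ha⟩ := hdec (u i - β • P.phi z)
    have heφ : M.form (realVec P.e) (P.phi z) = 1 := by rw [hphi, he]
    have h₃ : M.form (realVec P.e) (u i - β • P.phi z) = 0 := by
      rw [map_sub, map_smul, heφ, ← hβ, smul_eq_mul, mul_one, sub_self]
    have h₄ : M.form (P.phi z) (u i - β • P.phi z) = 0 := by
      rw [map_sub, map_smul, form_phi_self, LinearMap.mem_ker.1 (hu' i), smul_zero, sub_zero]
    set δ := M.form (realVec P.f) (u i - β • P.phi z) with hδ
    rw [h₃, zero_smul, add_zero] at ha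
    have hza : M.form (z : CVec n) (a : CVec n) = P.ip z a := rfl
    rw [ha, map_add, map_smul, M.form_comm (P.phi z) (realVec P.e), heφ] at h₄
    simp only [phi, map_add, map_smul, LinearMap.add_apply, LinearMap.smul_apply, form_e_LC,
      form_f_LC, hza, smul_eq_mul] at h₄
    have hδ' : δ = -P.ip z a := by linear_combination h₄
    refine ⟨a, hodgeMk_eq _ _ β ?_⟩
    rw [dphi, ← hδ', ← ha]
    module
  choose a ha using h₂
  have h₅ := h z hzt a
  rw [pull, dif_pos (show P.phi z ∈ M.aff Z₀ from hzt)] at h₅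
  simp only [ha, huv, h₅, mul_zero] at h₁
  exact h₁

/-! ### Vanishing of the constant term -/

lemma differentiableOn_ip {f g : P.LC → P.LC} {U : Set P.LC} (hf : DifferentiableOn ℂ f U)
    (hg : DifferentiableOn ℂ g U) : DifferentiableOn ℂ (fun z => P.ip (f z) (g z)) U := by
  simp only [ip, form_apply]
  refine DifferentiableOn.fun_sum fun i _ => DifferentiableOn.fun_sum fun j _ => ?_
  have h : ∀ i, ∀ f : P.LC → P.LC, DifferentiableOn ℂ f U →
      DifferentiableOn ℂ (fun z => (f z : CVec n) i) U := fun i f hf =>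
    ((ContinuousLinearMap.proj (R := ℂ) (φ := fun _ : Fin (n + 2) => ℂ) i).comp
      P.LC.subtypeL).differentiable.comp_differentiableOn hf
  exact ((h i f hf).mul (differentiableOn_const _)).mul (h j g hg)

lemma differentiableOn_autFactor (ξ : P.LC) (U : Set P.LC) :
    DifferentiableOn ℂ (P.autFactor ξ) U := by
  have h₁ := P.differentiableOn_ip (U := U) (differentiableOn_const ξ) differentiableOn_id
  have h₂ := P.differentiableOn_ip (U := U) differentiableOn_id differentiableOn_id
  exact ((differentiableOn_const 1).sub h₁).add (h₂.const_mul _)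

lemma differentiableOn_moebius {ξ : P.LC} (hξ : P.bar ξ = ξ) :
    DifferentiableOn ℂ (P.moebius ξ) (P.tube Z₀) := by
  have h₂ := P.differentiableOn_ip (U := P.tube Z₀) differentiableOn_id differentiableOn_id
  exact ((P.differentiableOn_autFactor ξ _).inv fun z hz => P.autFactor_ne_zero hξ hz).smul
    (differentiableOn_id.sub ((h₂.const_mul _).smul (differentiableOn_const ξ)))

lemma differentiableOn_moebiusDeriv {ξ : P.LC} (hξ : P.bar ξ = ξ) {f : P.LC → P.LC}
    (hf : DifferentiableOn ℂ f (P.tube Z₀)) :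
    DifferentiableOn ℂ (fun z => P.moebiusDeriv ξ z (f z)) (P.tube Z₀) := by
  have h₁ := P.differentiableOn_ip (U := P.tube Z₀) differentiableOn_id hf
  have h₂ := P.differentiableOn_ip (U := P.tube Z₀) (differentiableOn_const ξ) hf
  exact (hf.sub (h₁.smul (differentiableOn_const ξ))).sub
    ((h₂.neg.add (h₁.const_mul _)).smul (P.differentiableOn_moebius hξ))

/-- If the constant term vanishes identically, invariance under the transvection by `ξ` makes the
polynomial at `z` vanish at the value `∂ log j` of the automorphy factor. -/
lemma expansion_autFactorGrad_eq_zero {s : ℕ} {k : ℤ} {F : M.HodgeSection Z₀ s}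
    (hF : IsHomog k F) {γ : GL (Fin (n + 2)) ℤ} (hγF : IsInvariant γ F) {ξ : P.LC}
    (hξ : P.bar ξ = ξ) (hγ : ∀ x, act γ x = P.eichler ξ x) {d : ℕ}
    {c : (t : ℕ) → P.LC → MultilinearMap ℂ (fun _ : Fin (s + t) => P.LC) ℂ}
    (hol : ∀ t a, DifferentiableOn ℂ (fun z => c t z a) (P.tube Z₀))
    (hexp : ∀ z ∈ P.tube Z₀, ∀ a, P.pull F z a =
      ∑ t ∈ Finset.range (d + 1), c t z (Fin.append a (fun _ : Fin t => P.nu z)))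
    (h0 : ∀ z ∈ P.tube Z₀, c 0 z = 0) {z : P.LC} (hz : z ∈ P.tube Z₀) (a : Fin s → P.LC) :
    ∑ t ∈ Finset.range (d + 1), c t z (Fin.append a
      (fun _ : Fin t => (P.autFactor ξ z)⁻¹ • P.autFactorGrad ξ z)) = 0 := by
  let x : P.LC × P.LC → P.LC := fun p =>
    P.moebiusDeriv ξ p.1 (P.autFactor ξ p.1 • p.2 - P.autFactorGrad ξ p.1)
  have hx : ∀ l : P.LC →ₗ[ℂ] ℂ, IsHolPoly (P.tube Z₀) fun p => l (x p) := by
    intro l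
    have hl : ∀ {f : P.LC → P.LC}, DifferentiableOn ℂ f (P.tube Z₀) →
        DifferentiableOn ℂ (fun z => l (P.moebiusDeriv ξ z (f z))) (P.tube Z₀) := fun hf =>
      (LinearMap.toContinuousLinearMap l).differentiable.comp_differentiableOn
        (P.differentiableOn_moebiusDeriv hξ hf)
    have h₁ : IsHolPoly (P.tube Z₀) fun p =>
        (P.autFactor ξ p.1 • l.comp (P.moebiusDeriv ξ p.1)) p.2 :=
      IsHolPoly.linear_family (A := fun z => P.autFactor ξ z • l.comp (P.moebiusDeriv ξ z))
        fun b => (P.differentiableOn_autFactor ξ _).mul (hl (differentiableOn_const b))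
    have h₂ : IsHolPoly (P.tube Z₀) fun p =>
        -1 * l (P.moebiusDeriv ξ p.1 (P.autFactorGrad ξ p.1)) :=
      (IsHolPoly.const _).mul (.coeff (h := fun z =>
        l (P.moebiusDeriv ξ z (P.autFactorGrad ξ z))) (hl
          ((differentiableOn_const _).add ((differentiable_id.const_smul (1 / 2 * P.ip ξ ξ)).differentiableOn))))
    have h₃ := h₁.add h₂
    convert! h₃ using 2 with p
    simp [x, sub_eq_add_neg]
  let Q : P.LC × P.LC → ℂ := fun p =>
    (∑ t ∈ Finset.range (d + 1), c t p.1 (Fin.append a (fun _ : Fin t => p.2))) +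
    (-P.autFactor ξ p.1 ^ (-k)) * ∑ t ∈ Finset.range (d + 1), c t (P.moebius ξ p.1)
      (Fin.append (fun i => P.moebiusDeriv ξ p.1 (a i)) (fun _ : Fin t => x p))
  have hQ : IsHolPoly (P.tube Z₀) Q := by
    refine (P.isHolPoly_expansion d hol (v := fun _ => a) (x := Prod.snd)
      (fun i => differentiableOn_const _)
      fun l => .linear (LinearMap.toContinuousLinearMap l)).add (.mul ?_ ?_)
    · refine .coeff (h := fun z => -P.autFactor ξ z ^ (-k)) fun w hw => ?_
      exact (((P.differentiableOn_autFactor ξ _) w hw).zpow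
        (Or.inl (P.autFactor_ne_zero hξ hw))).neg
    · exact P.isHolPoly_expansion d (c := fun t z => c t (P.moebius ξ z))
        (fun t b => (hol t b).comp (P.differentiableOn_moebius hξ)
          fun w hw => P.moebius_mem_tube hξ hw)
        (fun i => P.differentiableOn_moebiusDeriv hξ (differentiableOn_const (a i))) hx
  have hQ0 : ∀ w ∈ P.tube Z₀, Q (w, P.nu w) = 0 := by
    intro w hw
    have h₁ := P.pull_moebius hF hγF hξ hγ hw a
    rw [hexp w hw, hexp _ (P.moebius_mem_tube hξ hw), P.nu_moebius hξ hw] at h₁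
    simp only [Q, x, h₁]
    ring
  have h := P.eq_zero_of_comp_nu_eq_zero hQ hQ0 z hz ((P.autFactor ξ z)⁻¹ • P.autFactorGrad ξ z)
  have hx0 : x (z, (P.autFactor ξ z)⁻¹ • P.autFactorGrad ξ z) = 0 := by
    simp only [x]
    rw [smul_smul, mul_inv_cancel₀ (P.autFactor_ne_zero hξ hz), one_smul, sub_self, map_zero]
  simp only [Q, hx0] at h
  rw [P.sum_append_zero d (fun t => c t (P.moebius ξ z)), h0 _ (P.moebius_mem_tube hξ hz)] at h
  simpa using h

lemma map_append_smul {s t : ℕ} (m : MultilinearMap ℂ (fun _ : Fin (s + t) => P.LC) ℂ)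
    (a : Fin s → P.LC) (r : ℂ) (x : P.LC) :
    m (Fin.append a (fun _ => r • x)) = r ^ t * m (Fin.append a (fun _ => x)) := by
  have h : (Fin.append a (fun _ : Fin t => r • x)) = fun i =>
      (Fin.append (fun _ : Fin s => (1 : ℂ)) (fun _ : Fin t => r) i) •
        Fin.append a (fun _ => x) i := by
    funext i
    refine Fin.addCases (fun i => ?_) (fun i => ?_) i <;> simp
  rw [h, MultilinearMap.map_smul_univ, Fin.prod_univ_add, smul_eq_mul]
  simp

/-- The constant term determines an invariant section. -/
lemma pull_eq_zero_of_constantTerm_eq_zero {P : M.HypPair} (hP : P.IsIntegral)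
    (Γ : Subgroup (M.OPlus Z₀)) (hΓ : Γ.FiniteIndex) {s : ℕ} {k : ℤ} {F : M.HodgeSection Z₀ s}
    (hF : IsHomog k F) (hinv : ∀ γ ∈ Γ, IsInvariant (γ : GL (Fin (n + 2)) ℤ) F)
    (hct : P.IsConstantTerm F 0) {z : P.LC} (hz : z ∈ P.tube Z₀) (a : Fin s → P.LC) :
    P.pull F z a = 0 := by
  obtain ⟨d, c, hol, hexp, hc⟩ := hct
  have h0 : ∀ w ∈ P.tube Z₀, c 0 w = 0 := fun w hw => (hc ⟨w, hw⟩).symm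
  -- The polynomial evaluated at `∂ log j`, with denominators cleared, as a function of `ξ ∈ L_ℂ`.
  let G : P.LC → ℂ := fun ξ => ∑ t ∈ Finset.range (d + 1), P.autFactor ξ z ^ (d - t) *
    c t z (Fin.append a (fun _ : Fin t => P.autFactorGrad ξ z))
  have hG : ∀ ξ, P.autFactor ξ z ≠ 0 → G ξ = P.autFactor ξ z ^ d *
      ∑ t ∈ Finset.range (d + 1), c t z (Fin.append a
        (fun _ : Fin t => (P.autFactor ξ z)⁻¹ • P.autFactorGrad ξ z)) := by
    intro ξ hξ
    rw [Finset.mul_sum]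
    refine Finset.sum_congr rfl fun t ht => ?_
    have htd : t ≤ d := Nat.lt_succ_iff.1 (Finset.mem_range.1 ht)
    rw [map_append_smul, ← mul_assoc]
    congr 1
    rw [pow_sub₀ _ hξ htd, inv_pow]
  have hpoly : ∀ ξ η, IsPolyFun fun t => G (ξ + t • η) := by
    intro ξ η
    refine IsPolyFun.sum fun t _ => IsPolyFun.mul (IsPolyFun.pow ?_ _)
      (IsPolyFun.multilinear_apply _ fun i l => ?_)
    · convert! IsPolyFun.quadratic (P.autFactor ξ z)
        (-P.ip η z + 1 / 2 * P.ip ξ η * P.ip z z) (1 / 4 * P.ip η η * P.ip z z) using 2 with t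
      simp only [autFactor, ip_add_left, ip_add_right, ip_smul_left, ip_smul_right,
        P.ip_comm η ξ]
      ring
    · refine Fin.addCases (fun i => ?_) (fun i => ?_) i
      · simp only [Fin.append_left]
        exact .const _
      · simp only [Fin.append_right]
        convert! IsPolyFun.quadratic (l (P.autFactorGrad ξ z))
          (-l η + P.ip ξ η * l z) (1 / 2 * P.ip η η * l z) using 2 with t
        simp only [autFactorGrad, ip_add_left, ip_add_right, ip_smul_left, ip_smul_right,
          P.ip_comm η ξ, map_add, map_neg, map_smul, smul_eq_mul]
        ring
  have hG0 : ∀ η ∈ P.latticeL, G η = 0 := by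
    intro η hη
    obtain ⟨N, hN, hγ⟩ := exists_multiples_act_eq_eichler hP Γ hΓ hη
    have h := (hpoly 0 η).eq_zero_of_nat_mul (N := (N : ℂ)) (by exact_mod_cast hN) (fun m => ?_) 1
    · simpa using h
    · obtain ⟨γ, hγΓ, hγ⟩ := hγ m
      have hreal : P.bar (((N : ℂ) * m) • η) = ((N : ℂ) * m) • η := by
        rw [bar_smul, bar_of_mem_latticeL hη, map_mul, map_natCast, map_natCast]
      rw [zero_add, hG _ (P.autFactor_ne_zero hreal hz),
        P.expansion_autFactorGrad_eq_zero hF (hinv γ hγΓ) hreal hγ hol hexp h0 hz, mul_zero]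
  have hG' : ∀ ξ, G ξ = 0 := fun ξ =>
    IsPolyFun.eq_zero_of_mem_span hpoly P.latticeL hG0 (span_latticeL hP ξ)
  -- The vector `ξ = 2 z̄ / ⟨z̄, z̄⟩` gives `∂ log j = ν(z)`.
  have hq : P.ip (P.bar z) (P.bar z) ≠ 0 := by
    rw [ip_bar_bar]
    refine (map_ne_zero _).2 fun hzz => P.form_f_ne_zero hz ?_
    simp [phi, hzz, form_f_LC, P.ff]
  have hD : P.ip (z - P.bar z) (z - P.bar z) ≠ 0 := by
    rw [ip_sub_bar]
    exact mul_ne_zero (by norm_num) (P.ip_imag_imag_ne_zero hz)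
  set w := P.bar z with hw
  set ξ : P.LC := (2 / P.ip w w) • w with hξ
  have hj : P.autFactor ξ z = P.ip (z - w) (z - w) / P.ip w w := by
    simp only [autFactor, hξ, ip_smul_left, ip_smul_right, ip_sub_left, ip_sub_right,
      P.ip_comm w z]
    field_simp
    ring
  have hj0 : P.autFactor ξ z ≠ 0 := by
    rw [hj]
    exact div_ne_zero hD hq
  have hgrad : (P.autFactor ξ z)⁻¹ • P.autFactorGrad ξ z = P.nu z := by
    rw [nu_eq, hj, ← hw, autFactorGrad, hξ]
    simp only [ip_smul_left, ip_smul_right]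
    match_scalars
    · field_simp
    · field_simp
  have h := hG ξ hj0
  rw [hG', hgrad, ← hexp z hz] at h
  exact (mul_eq_zero.1 h.symm).resolve_left (pow_ne_zero d hj0)

end HypPair

end OrthLattice

theorem mainTheorem1 {n : ℕ} (M : OrthLattice n) (Z₀ : CVec n) (hZ₀ : Z₀ ∈ M.cone)
    (P : M.HypPair) (hP : P.IsIntegral) (Γ : Subgroup (M.OPlus Z₀)) (hΓ : Γ.FiniteIndex)
    (k : ℤ) (s : ℕ) :
    (∀ F ∈ OrthLattice.AHMod k s Γ, ∃! f, P.IsConstantTerm F f) ∧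
      ∃ ct : OrthLattice.AHMod k s Γ ≃ₗ[ℂ] P.QMod k s Γ,
        ∀ F : OrthLattice.AHMod k s Γ,
          P.IsConstantTerm (F : M.HodgeSection Z₀ s)
            (ct F : P.tube Z₀ → MultilinearMap ℂ (fun _ : Fin s => P.LC) ℂ) := by
  have hex : ∀ F ∈ OrthLattice.AHMod k s Γ, ∃! f, P.IsConstantTerm F f := by
    intro F hF
    obtain ⟨d, hd⟩ := hF.almostHolomorphic
    obtain ⟨f, hf⟩ := P.exists_hasConstantTerm (d + 1) (P.pull F) (hF.smooth P)
      (fun z hz => P.pull_multilinear F hz) (hd P)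
    exact ⟨f, hf, fun g hg => OrthLattice.HypPair.HasConstantTerm.unique P hg hf⟩
  refine ⟨hex, ?_⟩
  choose f hf using fun F : OrthLattice.AHMod k s Γ => (hex F F.2).exists
  have huniq : ∀ (F : OrthLattice.AHMod k s Γ) g, P.IsConstantTerm (F : M.HodgeSection Z₀ s) g →
      f F = g := fun F g hg => OrthLattice.HypPair.HasConstantTerm.unique P (hf F) hg
  have hcomb : ∀ (c : ℂ) (F G H : OrthLattice.AHMod k s Γ),
      (H : M.HodgeSection Z₀ s) = c • (F : M.HodgeSection Z₀ s) + G → f H = c • f F + f G := by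
    intro c F G H h
    refine huniq H _ (OrthLattice.HypPair.HasConstantTerm.comb c (hf F) (hf G) fun z _ a => ?_)
    rw [h, P.pull_comb]
  have hzero : f 0 = 0 := by
    have := hcomb (-1) 0 0 0 (by simp)
    simpa using this
  let ct : OrthLattice.AHMod k s Γ →ₗ[ℂ] P.QMod k s Γ :=
    { toFun := fun F => ⟨f F, F, F.2, hf F⟩
      map_add' := fun F G => Subtype.ext (by
        have := hcomb 1 F G (F + G) (by simp)
        simpa using this)
      map_smul' := fun c F => Subtype.ext (by
        have := hcomb c F 0 (c • F) (by simp)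
        simpa [hzero] using this) }
  have hinj : Function.Injective ct := by
    rw [← LinearMap.ker_eq_bot, LinearMap.ker_eq_bot']
    intro F hF
    have h0 : f F = 0 := congrArg Subtype.val hF
    have hFct := hf F
    rw [h0] at hFct
    exact Subtype.ext (P.eq_zero_of_pull_eq_zero F.2.homog fun z hz a =>
      OrthLattice.HypPair.pull_eq_zero_of_constantTerm_eq_zero hP Γ hΓ F.2.homog F.2.invariant
        hFct hz a)
  have hsurj : Function.Surjective ct := by
    rintro ⟨g, F, hF, hg⟩
    exact ⟨⟨F, hF⟩, Subtype.ext (huniq ⟨F, hF⟩ g hg)⟩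
  exact ⟨LinearEquiv.ofBijective ct ⟨hinj, hsurj⟩, hf⟩
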